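/- Let $s\in(0,1]$ and $L>0$, and let $\mathcal H^s_L([0,1])$ be the set of all probability densities $f$ on $[0,1]$ (with respect to Lebesgue measure) such that $|f(x)-f(y)|\le L|x-y|^s$ for all $x,y\in[0,1]$. For integers $n,k\ge 1$, let $X_1,\dots,X_n$ be i.i.d. with density $f\in\mathcal H^s_L([0,1])$, where $X_i$ is observed by node $i$. An *independent protocol* is given by measurable conditional probabilities $p_i(m\mid x)$, $i\in[n]$, $m\in[2^k]$, $x\in[0,1]$: given $X_1,\dots,X_n$, the messages $M_i\sim p_i(\cdot\mid X_i)$ are drawn independently, and the transcript is $Y=(M_1,\dots,M_n)$. A *blackboard protocol* is a complete binary tree of depth $nk$ in which each internal vertex $v$ carries a label $l_v\in[n]$ and a measurable function $b_v:[0,1]\to[0,1]$, such that for each $i\in[n]$ every path from the root to a leaf visits exactly $k$ internal vertices with label $i$. Starting at the root, at vertex $v$ node $l_v$ writes, using fresh independent randomness, the bit $1$ with probability $b_v(X_{l_v})$ and the bit $0$ otherwise, and the protocol moves to the corresponding child of $v$; the transcript $Y\in\{0,1\}^{nk}$ is the sequence of all bits written. An estimator $\hat f=\hat f(Y)$ assigns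 to each value of the transcript a measurable function $[0,1]\to\mathbb R$, and $\|\cdot\|_2$ is the norm of $L^2([0,1])$. There are constants $c,C>0$ depending only on $s$ and $L$ such that the following holds for all integers $n,k\ge1$. 1. For every blackboard protocol and every estimator $\hat f(Y)$, $$\sup_{f\in\mathcal H^s_L([0,1])}\mathbb E\|f-\hat f\|_2^2\ \ge\ c\max\left\{n^{-\frac{2s}{2s+1}},\,(n2^k)^{-\frac{s}{s+1}}\right\}.$$ 2. There are an independent protocol and an estimator $\hat f(Y)$ such that $$\sup_{f\in\mathcal H^s_L([0,1])}\mathbb E\|f-\hat f\|_2^2\ \le\ C\max\left\{n^{-\frac{2s}{2s+1}},\,(n2^k)^{-\frac{s}{s+1}}\right\}.$$ -/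

import Mathlib

open MeasureTheory
open scoped ENNReal

noncomputable section

/-- An independent `k`-bit protocol for `n` nodes with samples in `𝒳`: node `i` encodes its sample
`x` into a message `m ∈ [2^k]` drawn with conditional probability `p(m | x) = enc i x m`. -/
structure IndependentProtocol (𝒳 : Type*) [MeasurableSpace 𝒳] (n k : ℕ) where
  enc : Fin n → 𝒳 → Fin (2 ^ k) → ℝ
  measurable_enc : ∀ i m, Measurable fun x => enc i x m
  enc_nonneg : ∀ i x m, 0 ≤ enc i x m
  sum_enc : ∀ i x, ∑ m, enc i x m = 1

/-- Conditional probability that the messages are `m = (m₁, …, mₙ)` given that the samples are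
`x = (x₁, …, xₙ)`. -/
def IndependentProtocol.transcriptProb {𝒳 : Type*} [MeasurableSpace 𝒳] {n k : ℕ}
    (P : IndependentProtocol 𝒳 n k) (x : Fin n → 𝒳) (m : Fin n → Fin (2 ^ k)) : ℝ :=
  ∏ i, P.enc i (x i) (m i)

/-- The first `t` bits of the transcript `y`: the node at depth `t` of the complete binary tree of
depth `N` on the path determined by `y`. -/
def pathNode {N : ℕ} (y : Fin N → Bool) (t : Fin N) : List Bool :=
  (List.ofFn y).take t

/-- A blackboard `k`-bit protocol for `n` nodes with samples in `𝒳`, viewed as a labelled complete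
binary tree of depth `n * k`. A vertex of the tree is the list of bits written on the blackboard so
far (only lists of length less than `n * k` are internal vertices; the values of the functions
on longer lists are never used). At vertex `v`, the node `label v` writes the bit `1` with probability
`bit v x` and `0` with probability `1 - bit v x`, where `x` is the sample of that node.
Every path from the root to a leaf visits exactly `k` internal vertices with label `i`,
for each `i`. -/
structure BlackboardProtocol (𝒳 : Type*) [MeasurableSpace 𝒳] (n k : ℕ) where
  label : List Bool → Fin n
  bit : List Bool → 𝒳 → ℝ
  measurable_bit : ∀ v, Measurable (bit v)
  bit_mem : ∀ v x, bit v x ∈ Set.Icc (0 : ℝ) 1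
  budget : ∀ (y : Fin (n * k) → Bool) (i : Fin n),
    (Finset.univ.filter fun t : Fin (n * k) => label (pathNode y t) = i).card = k

/-- Conditional probability that the final transcript is `y` given that the samples are
`x = (x₁, …, xₙ)`. -/
def BlackboardProtocol.transcriptProb {𝒳 : Type*} [MeasurableSpace 𝒳] {n k : ℕ}
    (P : BlackboardProtocol 𝒳 n k) (x : Fin n → 𝒳) (y : Fin (n * k) → Bool) : ℝ :=
  ∏ t, if y t then P.bit (pathNode y t) (x (P.label (pathNode y t)))
    else 1 - P.bit (pathNode y t) (x (P.label (pathNode y t)))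

/-- The probability densities on `[0,1]` (with respect to Lebesgue measure) that are Hölder
continuous with smoothness `s` and constant `L`. -/
def holderDensities (s L : ℝ) : Set (unitInterval → ℝ) :=
  {f | (∀ x, 0 ≤ f x) ∧ (∫ x, f x = 1) ∧
    ∀ x y : unitInterval, |f x - f y| ≤ L * |(x : ℝ) - (y : ℝ)| ^ s}

/-- The law on `[0,1]` of a sample with density `f`. -/
def sampleLaw (f : unitInterval → ℝ) : Measure unitInterval :=
  volume.withDensity fun x => ENNReal.ofReal (f x)

/-- The risk `𝔼 ‖f - f̂(Y)‖₂²`, where `X₁, …, Xₙ` are i.i.d. with density `f` and the transcript `Y`,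
with values in a finite set, has conditional probabilities `q x y` given `X = x`. -/
def l2Risk {n : ℕ} {𝒴 : Type*} [Fintype 𝒴] (q : (Fin n → unitInterval) → 𝒴 → ℝ)
    (fhat : 𝒴 → unitInterval → ℝ) (f : unitInterval → ℝ) : ℝ≥0∞ :=
  ∫⁻ x, ∑ y, ENNReal.ofReal (q x y) * eLpNorm (fun u => f u - fhat y u) 2 volume ^ 2
    ∂(Measure.pi fun _ : Fin n => sampleLaw f)

/-- The rate `max {n^{-2s/(2s+1)}, (n 2^k)^{-s/(s+1)}}`. -/
def minimaxRate (s : ℝ) (n k : ℕ) : ℝ :=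
  max ((n : ℝ) ^ (-(2 * s / (2 * s + 1)))) (((n : ℝ) * 2 ^ k) ^ (-(s / (s + 1))))

end

/-! Both bounds compare `f` with functions resolved at scale `1/d`, where `d` is `binCount = min
(n^(1/(2s+1))) ((n 2^k)^(1/(2s+2)))` up to rounding; the rate is then of order `d^(-2s)`.

Lower bound: Assouad's method on the cube of `2^d` densities `perturbedDensity`, with one sine wave
of amplitude `ε ≍ d^(-s)` and free sign per bin. However interactive the protocol, the probability
of a transcript is a product of functions of the single samples (`transcriptProb_eq_prod`). Hence
flipping the sign of bin `j` turns each factor `a_i` of the transcript law into `a_i + δ_i`. In the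
Bhattacharyya affinity the first-order terms cancel, leaving a loss of at most `∑_i ∑_y (∏_{l≠i}
a_l) δ_i² / a_i` (`one_sub_le_sum_sqrt`). Summed over the bins, `δ_i² / a_i` has two bounds
(`sum_sq_integral_flipAt_sub_le`): `16 ε² a_i`, which has total weight `16 ε²`, and `8 ε² / d`,
which has total weight `2^k · 8 ε² / d`, because `∏_{l≠i} a_l` sums to `2^k`
(`sum_prod_erase_integral`). So if `n ε² ≲ d` or `n 2^k ε² ≲ d²`, a fixed share of the signs stays
undecided, each at a cost of order `ε² / d`. The choice of `d` makes one alternative true.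

Upper bound: a histogram. The bins are split into `G ≲ 1 + d / 2^k` groups of at most `2^k - 1`, and
about `n / G` nodes serve each group, reporting which of its bins holds the sample, or none. The
squared bias is `d^(-2s)` and the variance is `d G / n ≲ d / n + d² / (n 2^k)`, both of the order of
the rate (`l2Risk_histogramEstimator_le`). -/

/-! ### Equal bins of the unit interval -/

/-- The index of the bin containing `x` when `[0,1]` is cut into `d` equal bins. -/
noncomputable def binIndex (d : ℕ) [NeZero d] (x : unitInterval) : Fin d :=
  ⟨min ⌊(d : ℝ) * x⌋₊ (d - 1), by have := NeZero.pos d; omega⟩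

lemma measurable_binIndex (d : ℕ) [NeZero d] : Measurable (binIndex d) := by
  have h : Measurable fun x : unitInterval => min ⌊(d : ℝ) * x⌋₊ (d - 1) := by fun_prop
  refine measurable_to_countable' fun j => ?_
  have : binIndex d ⁻¹' {j} = (fun x : unitInterval => min ⌊(d : ℝ) * x⌋₊ (d - 1)) ⁻¹' {(j : ℕ)} := by
    ext x
    simp [binIndex, Fin.ext_iff]
  rw [this]
  exact h (measurableSet_singleton _)

lemma measurableSet_bin (d : ℕ) [NeZero d] (j : Fin d) :
    MeasurableSet {x | binIndex d x = j} :=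
  measurable_binIndex d (measurableSet_singleton j)

lemma binIndex_le_mul (d : ℕ) [NeZero d] (x : unitInterval) : (binIndex d x : ℝ) ≤ d * x := by
  have h : ((binIndex d x : ℕ) : ℝ) ≤ (⌊(d : ℝ) * x⌋₊ : ℝ) := by
    exact_mod_cast min_le_left _ _
  exact h.trans (Nat.floor_le (mul_nonneg (Nat.cast_nonneg d) x.2.1))

lemma mul_le_binIndex_add_one (d : ℕ) [NeZero d] (x : unitInterval) :
    d * (x : ℝ) ≤ binIndex d x + 1 := by
  have hd := NeZero.pos d
  rcases le_total ⌊(d : ℝ) * x⌋₊ (d - 1) with h | h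
  · have : (binIndex d x : ℕ) = ⌊(d : ℝ) * x⌋₊ := min_eq_left h
    rw [this]
    exact (Nat.lt_floor_add_one _).le
  · have : (binIndex d x : ℕ) = d - 1 := min_eq_right h
    rw [this, Nat.cast_sub hd, Nat.cast_one, sub_add_cancel]
    exact mul_le_of_le_one_right (Nat.cast_nonneg d) x.2.2

/-- Two points of the same bin are at distance at most `1 / d`. -/
lemma abs_sub_le_of_binIndex_eq {d : ℕ} [NeZero d] {x y : unitInterval}
    (h : binIndex d x = binIndex d y) : |(x : ℝ) - y| ≤ 1 / d := by
  have hd : (0 : ℝ) < d := by exact_mod_cast NeZero.pos d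
  have h1 := binIndex_le_mul d x
  have h2 := mul_le_binIndex_add_one d x
  have h3 := binIndex_le_mul d y
  have h4 := mul_le_binIndex_add_one d y
  rw [h] at h1 h2
  rw [le_div_iff₀ hd, ← abs_of_pos hd, ← abs_mul, abs_le]
  constructor <;> nlinarith

/-- Up to a null set, the `j`-th bin is `(j/d, (j+1)/d]`. -/
lemma bin_ae_eq (d : ℕ) [NeZero d] (j : Fin d) :
    {x | binIndex d x = j} =ᵐ[volume]
      ((↑) : unitInterval → ℝ) ⁻¹' Set.Ioc ((j : ℝ) / d) (((j : ℝ) + 1) / d) := by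
  have hd : (0 : ℝ) < d := by exact_mod_cast NeZero.pos d
  have hj : ((j : ℕ) : ℝ) + 1 ≤ d := by exact_mod_cast j.2
  have hne : ∀ r ∈ Set.Icc (0 : ℝ) 1, ∀ᵐ x : unitInterval, (x : ℝ) ≠ r := by
    intro r hr
    have : ∀ᵐ x : unitInterval, x ≠ ⟨r, hr⟩ := by
      rw [ae_iff]
      simp
    filter_upwards [this] with x hx h
    exact hx (Subtype.ext h)
  have h0 := hne ((j : ℝ) / d) ⟨by positivity, by rw [div_le_one hd]; linarith⟩
  have h1 := hne (((j : ℝ) + 1) / d) ⟨by positivity, by rw [div_le_one hd]; linarith⟩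
  filter_upwards [h0, h1] with x hx0 hx1
  apply propext
  change binIndex d x = j ↔ (j : ℝ) / d < x ∧ (x : ℝ) ≤ ((j : ℝ) + 1) / d
  constructor
  · rintro rfl
    refine ⟨lt_of_le_of_ne ?_ hx0.symm, ?_⟩
    · rw [div_le_iff₀ hd, mul_comm]; exact binIndex_le_mul d x
    · rw [le_div_iff₀ hd, mul_comm]; exact mul_le_binIndex_add_one d x
  · rintro ⟨ha, hb⟩
    have hb' := lt_of_le_of_ne hb hx1
    rw [div_lt_iff₀ hd, mul_comm] at ha
    rw [lt_div_iff₀ hd, mul_comm] at hb'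
    have : ⌊(d : ℝ) * x⌋₊ = j := by
      rw [Nat.floor_eq_iff (mul_nonneg hd.le x.2.1)]
      exact ⟨ha.le, hb'⟩
    ext
    simp only [binIndex, this]
    have := j.2
    omega

lemma setIntegral_bin (d : ℕ) [NeZero d] (j : Fin d) (g : ℝ → ℝ) :
    ∫ x in {x | binIndex d x = j}, g x = ∫ x in ((j : ℝ) / d)..(((j : ℝ) + 1) / d), g x := by
  have hd : (0 : ℝ) < d := by exact_mod_cast NeZero.pos d
  have hj : ((j : ℕ) : ℝ) + 1 ≤ d := by exact_mod_cast j.2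
  rw [setIntegral_congr_set (bin_ae_eq d j),
    unitInterval.measurePreserving_coe.setIntegral_preimage_emb
      unitInterval.measurableEmbedding_coe,
    intervalIntegral.integral_of_le (by gcongr; linarith), Measure.restrict_restrict
      measurableSet_Ioc]
  congr 2
  refine Set.inter_eq_left.2 fun x hx => ⟨?_, ?_⟩
  · exact (lt_of_le_of_lt (by positivity) hx.1).le
  · exact hx.2.trans (by rw [div_le_one hd]; exact hj)

lemma volume_real_bin (d : ℕ) [NeZero d] (j : Fin d) :
    volume.real {x | binIndex d x = j} = 1 / d := by
  have := setIntegral_bin d j fun _ => 1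
  simp only [setIntegral_const, smul_eq_mul, mul_one, intervalIntegral.integral_const] at this
  rw [this]
  ring

/-- A bin is exactly one period of the wave. This is why a perturbation of either sign leaves the
mass of every bin unchanged. -/
lemma integral_sin_bin (d : ℕ) [NeZero d] (j : Fin d) :
    ∫ x in {x | binIndex d x = j}, Real.sin (2 * Real.pi * d * (x : unitInterval)) = 0 := by
  have hd : (d : ℝ) ≠ 0 := by exact_mod_cast NeZero.ne d
  have hc : 2 * Real.pi * d ≠ 0 := by positivity
  rw [setIntegral_bin d j fun x => Real.sin (2 * Real.pi * d * x),
    intervalIntegral.integral_comp_mul_left (fun x => Real.sin x) hc, integral_sin]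
  have h1 : 2 * Real.pi * d * ((j : ℝ) / d) = (j : ℕ) * (2 * Real.pi) := by field_simp
  have h2 : 2 * Real.pi * d * (((j : ℝ) + 1) / d) = ((j : ℕ) + 1 : ℕ) * (2 * Real.pi) := by
    push_cast; field_simp
  rw [h1, h2, Real.cos_nat_mul_two_pi, Real.cos_nat_mul_two_pi]
  simp

lemma integral_sin_sq_bin (d : ℕ) [NeZero d] (j : Fin d) :
    ∫ x in {x | binIndex d x = j}, Real.sin (2 * Real.pi * d * (x : unitInterval)) ^ 2
      = 1 / (2 * d) := by
  have hd : (d : ℝ) ≠ 0 := by exact_mod_cast NeZero.ne d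
  have hc : 2 * Real.pi * d ≠ 0 := by positivity
  rw [setIntegral_bin d j fun x => Real.sin (2 * Real.pi * d * x) ^ 2,
    intervalIntegral.integral_comp_mul_left (fun x => Real.sin x ^ 2) hc, integral_sin_sq]
  have h1 : 2 * Real.pi * d * ((j : ℝ) / d) = (j : ℕ) * (2 * Real.pi) := by field_simp
  have h2 : 2 * Real.pi * d * (((j : ℝ) + 1) / d) = ((j : ℕ) + 1 : ℕ) * (2 * Real.pi) := by
    push_cast; field_simp
  have hs : ∀ m : ℕ, Real.sin (m * (2 * Real.pi)) = 0 := fun m => by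
    have := Real.sin_nat_mul_pi (2 * m)
    push_cast at this
    rw [← this]; ring_nf
  rw [h1, h2, hs, hs]
  push_cast
  simp only [smul_eq_mul]
  field_simp
  ring

/-! ### The balanced number of bins -/

/-- The real number of bins that balances bias and variance. -/
noncomputable def binCount (s : ℝ) (n k : ℕ) : ℝ :=
  min ((n : ℝ) ^ (1 / (2 * s + 1))) (((n : ℝ) * 2 ^ k) ^ (1 / (2 * s + 2)))

section binCount

variable {s : ℝ} {n k : ℕ}

lemma one_le_binCount (hs : 0 < s) (hn : 1 ≤ n) : 1 ≤ binCount s n k := by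
  have h1 : (1 : ℝ) ≤ n := by exact_mod_cast hn
  have h2 : (1 : ℝ) ≤ 2 ^ k := one_le_pow₀ (by norm_num)
  exact le_min (Real.one_le_rpow h1 (by positivity))
    (Real.one_le_rpow (by nlinarith) (by positivity))

lemma rpow_rpow_one_div {x a : ℝ} (hx : 0 ≤ x) (ha : 0 < a) : (x ^ (1 / a)) ^ a = x := by
  rw [← Real.rpow_mul hx, one_div_mul_cancel ha.ne', Real.rpow_one]

lemma binCount_rpow_le (hs : 0 < s) : binCount s n k ^ (2 * s + 1) ≤ n := by
  calc binCount s n k ^ (2 * s + 1) ≤ ((n : ℝ) ^ (1 / (2 * s + 1))) ^ (2 * s + 1) :=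
        Real.rpow_le_rpow (by unfold binCount; positivity) (min_le_left _ _) (by positivity)
    _ = n := rpow_rpow_one_div (by positivity) (by positivity)

lemma binCount_rpow_le' (hs : 0 < s) : binCount s n k ^ (2 * s + 2) ≤ n * 2 ^ k := by
  calc binCount s n k ^ (2 * s + 2) ≤ (((n : ℝ) * 2 ^ k) ^ (1 / (2 * s + 2))) ^ (2 * s + 2) :=
        Real.rpow_le_rpow (by unfold binCount; positivity) (min_le_right _ _) (by positivity)
    _ = n * 2 ^ k := rpow_rpow_one_div (by positivity) (by positivity)

/-- The minimum is attained by one of its two terms; this decides which of the two information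
bounds the lower bound uses. -/
lemma binCount_rpow_eq (hs : 0 < s) :
    binCount s n k ^ (2 * s + 1) = n ∨ binCount s n k ^ (2 * s + 2) = n * 2 ^ k := by
  rcases min_choice ((n : ℝ) ^ (1 / (2 * s + 1))) (((n : ℝ) * 2 ^ k) ^ (1 / (2 * s + 2)))
    with h | h
  · left
    rw [binCount, h, rpow_rpow_one_div (by positivity) (by positivity)]
  · right
    rw [binCount, h, rpow_rpow_one_div (by positivity) (by positivity)]

/-- The decreasing map `x ↦ x^(-2s)` turns the minimum into the maximum of the two rates. -/
lemma minimaxRate_eq (hs : 0 < s) (hn : 1 ≤ n) :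
    minimaxRate s n k = binCount s n k ^ (-(2 * s)) := by
  have h1 : (0 : ℝ) < n := by exact_mod_cast hn
  have h2 : (0 : ℝ) < n * 2 ^ k := by positivity
  have ha : (n : ℝ) ^ (-(2 * s / (2 * s + 1))) = ((n : ℝ) ^ (1 / (2 * s + 1))) ^ (-(2 * s)) := by
    rw [← Real.rpow_mul h1.le]; congr 1; ring
  have hb : ((n : ℝ) * 2 ^ k) ^ (-(s / (s + 1)))
      = (((n : ℝ) * 2 ^ k) ^ (1 / (2 * s + 2))) ^ (-(2 * s)) := by
    rw [← Real.rpow_mul h2.le]; congr 1; field_simp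
  have hanti : AntitoneOn (fun x : ℝ => x ^ (-(2 * s))) (Set.Ioi 0) := fun x hx y _ hxy =>
    Real.rpow_le_rpow_of_nonpos hx hxy (by linarith)
  rw [minimaxRate, ha, hb, binCount]
  exact (hanti.map_min (Real.rpow_pos_of_pos h1 _) (Real.rpow_pos_of_pos h2 _)).symm

end binCount

/-! ### Blackboard protocols -/

/-- Along the paths of a binary tree whose vertices carry the probability of the bit `1`, the path
probabilities sum to one. -/
lemma sum_prod_pathNode (N : ℕ) (B : List Bool → ℝ) :
    ∑ y : Fin N → Bool, ∏ t, (if y t then B (pathNode y t) else 1 - B (pathNode y t)) = 1 := by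
  -- The first bit is split off, and the subtree below the bit `b` is the same problem for `B (b ::
  -- ·)`; hence the generalization over `B`.
  induction N generalizing B with
  | zero => simp
  | succ N ih =>
    rw [← (Fin.consEquiv fun _ : Fin (N + 1) => Bool).sum_comp, Fintype.sum_prod_type]
    have h : ∀ (b : Bool) (y : Fin N → Bool),
        (∏ t, if (Fin.consEquiv fun _ : Fin (N + 1) => Bool) (b, y) t
            then B (pathNode ((Fin.consEquiv fun _ : Fin (N + 1) => Bool) (b, y)) t)
            else 1 - B (pathNode ((Fin.consEquiv fun _ : Fin (N + 1) => Bool) (b, y)) t))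
          = (if b then B [] else 1 - B []) *
            ∏ t, if y t then B (b :: pathNode y t) else 1 - B (b :: pathNode y t) := by
      intro b y
      rw [Fin.prod_univ_succ]
      simp [Fin.consEquiv, pathNode, List.ofFn_succ]
    simp_rw [h, ← Finset.mul_sum]
    simp [ih fun v => B (true :: v), ih fun v => B (false :: v)]

namespace BlackboardProtocol

variable {𝒳 : Type*} [MeasurableSpace 𝒳] {n k : ℕ} (P : BlackboardProtocol 𝒳 n k)

lemma sum_transcriptProb (x : Fin n → 𝒳) : ∑ y, P.transcriptProb x y = 1 :=
  sum_prod_pathNode (n * k) fun v => P.bit v (x (P.label v))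

/-- The contribution of node `i` to the likelihood of the transcript `y`. -/
noncomputable def nodeLikelihood (i : Fin n) (y : Fin (n * k) → Bool) (u : 𝒳) : ℝ :=
  ∏ t with P.label (pathNode y t) = i,
    if y t then P.bit (pathNode y t) u else 1 - P.bit (pathNode y t) u

/-- For a fixed transcript the visited vertices are fixed, and the sample of node `i` enters only at
those labelled `i`. Grouping the bits by their writer separates the samples despite the interaction.
-/
lemma transcriptProb_eq_prod (x : Fin n → 𝒳) (y : Fin (n * k) → Bool) :
    P.transcriptProb x y = ∏ i, P.nodeLikelihood i y (x i) := by
  rw [transcriptProb, ← Finset.prod_fiberwise Finset.univ fun t => P.label (pathNode y t)]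
  refine Finset.prod_congr rfl fun i _ => Finset.prod_congr rfl fun t ht => ?_
  rw [(Finset.mem_filter.1 ht).2]

lemma measurable_nodeLikelihood (i : Fin n) (y : Fin (n * k) → Bool) :
    Measurable (P.nodeLikelihood i y) := by
  refine Finset.measurable_prod _ fun t _ => ?_
  have := P.measurable_bit (pathNode y t)
  split_ifs <;> fun_prop

lemma nodeLikelihood_nonneg (i : Fin n) (y : Fin (n * k) → Bool) (u : 𝒳) :
    0 ≤ P.nodeLikelihood i y u := by
  refine Finset.prod_nonneg fun t _ => ?_
  have := P.bit_mem (pathNode y t) u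
  split_ifs
  · exact this.1
  · linarith [this.2]

lemma nodeLikelihood_le_one (i : Fin n) (y : Fin (n * k) → Bool) (u : 𝒳) :
    P.nodeLikelihood i y u ≤ 1 := by
  refine Finset.prod_le_one (fun t _ => ?_) fun t _ => ?_ <;>
  · have := P.bit_mem (pathNode y t) u
    split_ifs <;> linarith [this.1, this.2]

lemma integrable_nodeLikelihood_mul {μ : Measure 𝒳} (i : Fin n) (y : Fin (n * k) → Bool)
    {g : 𝒳 → ℝ} (hg : Integrable g μ) : Integrable (fun u => P.nodeLikelihood i y u * g u) μ := by
  refine hg.bdd_mul (c := 1) (P.measurable_nodeLikelihood i y).aestronglyMeasurable ?_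
  refine .of_forall fun u => ?_
  rw [Real.norm_of_nonneg (P.nodeLikelihood_nonneg i y u)]
  exact P.nodeLikelihood_le_one i y u

/-- Total mass of the transcript when the samples have arbitrary signed densities. -/
lemma sum_prod_integral {μ : Measure 𝒳} [SigmaFinite μ] (g : Fin n → 𝒳 → ℝ)
    (hg : ∀ i, Integrable (g i) μ) :
    ∑ y, ∏ i, ∫ u, P.nodeLikelihood i y u * g i u ∂μ = ∏ i, ∫ u, g i u ∂μ := by
  have h : ∀ y, ∏ i, ∫ u, P.nodeLikelihood i y u * g i u ∂μ
      = ∫ x, P.transcriptProb x y * ∏ i, g i (x i) ∂(Measure.pi fun _ => μ) := by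
    intro y
    rw [← integral_fintype_prod_eq_prod (fun i u => P.nodeLikelihood i y u * g i u)]
    refine integral_congr_ae (.of_forall fun x => ?_)
    simp only [P.transcriptProb_eq_prod, Finset.prod_mul_distrib]
  have hint : ∀ y, Integrable (fun x => P.transcriptProb x y * ∏ i, g i (x i))
      (Measure.pi fun _ : Fin n => μ) := by
    intro y
    have := Integrable.fintype_prod (μ := fun _ : Fin n => μ)
      fun i => P.integrable_nodeLikelihood_mul i y (hg i)
    simpa only [P.transcriptProb_eq_prod, Finset.prod_mul_distrib] using this
  simp_rw [h]
  rw [← integral_finsetSum _ fun y _ => hint y, ← integral_fintype_prod_eq_prod (fun i u => g i u)]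
  refine integral_congr_ae (.of_forall fun x => ?_)
  simp only [← Finset.sum_mul, P.sum_transcriptProb, one_mul]

/-- The protocol in which node `i` writes fair coin flips, whatever its sample. -/
noncomputable def withCoins (i : Fin n) : BlackboardProtocol 𝒳 n k where
  label := P.label
  bit v u := if P.label v = i then 1 / 2 else P.bit v u
  measurable_bit v := by
    have := P.measurable_bit v
    split_ifs <;> fun_prop
  bit_mem v u := by
    split_ifs
    · norm_num
    · exact P.bit_mem v u
  budget := P.budget

lemma nodeLikelihood_withCoins_self (i : Fin n) (y : Fin (n * k) → Bool) (u : 𝒳) :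
    (P.withCoins i).nodeLikelihood i y u = (1 / 2) ^ k := by
  have h : ∀ t ∈ Finset.univ.filter fun t => P.label (pathNode y t) = i,
      (if y t then (P.withCoins i).bit (pathNode y t) u
        else 1 - (P.withCoins i).bit (pathNode y t) u) = 1 / 2 := by
    intro t ht
    simp only [withCoins, (Finset.mem_filter.1 ht).2, if_true]
    split_ifs <;> norm_num
  refine (Finset.prod_congr rfl h).trans ?_
  -- The bit budget yields the factor `2^(-k)` here: node `i` writes exactly `k` coin flips on every
  -- path.
  rw [Finset.prod_const, P.budget y i]

lemma nodeLikelihood_withCoins_of_ne {i i' : Fin n} (h : i' ≠ i) (y : Fin (n * k) → Bool)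
    (u : 𝒳) : (P.withCoins i).nodeLikelihood i' y u = P.nodeLikelihood i' y u := by
  refine Finset.prod_congr rfl fun t ht => ?_
  have : P.label (pathNode y t) = i' := (Finset.mem_filter.1 ht).2
  simp only [withCoins, this, h, if_false]

/-- Summed over all transcripts, the likelihoods of the nodes other than `i` have mass `2 ^ k`. -/
lemma sum_prod_erase_integral {μ : Measure 𝒳} [SigmaFinite μ] (f : 𝒳 → ℝ)
    (hf : Integrable f μ) (hf1 : ∫ u, f u ∂μ = 1) (i : Fin n) :
    ∑ y, ∏ i' ∈ Finset.univ.erase i, ∫ u, P.nodeLikelihood i' y u * f u ∂μ = 2 ^ k := by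
  -- Replacing node `i` by coins gives a genuine protocol, of total mass one, in which the factor of
  -- node `i` is the constant `2^(-k)`.
  have h := (P.withCoins i).sum_prod_integral (fun _ => f) fun _ => hf
  simp only [hf1, Finset.prod_const_one] at h
  have h2 : ∀ y, ∏ i', ∫ u, (P.withCoins i).nodeLikelihood i' y u * f u ∂μ
      = (1 / 2) ^ k * ∏ i' ∈ Finset.univ.erase i, ∫ u, P.nodeLikelihood i' y u * f u ∂μ := by
    intro y
    rw [← Finset.mul_prod_erase _ _ (Finset.mem_univ i)]
    congr 1
    · simp only [nodeLikelihood_withCoins_self, integral_const_mul, hf1, mul_one]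
    · refine Finset.prod_congr rfl fun i' hi' => ?_
      simp only [P.nodeLikelihood_withCoins_of_ne (Finset.ne_of_mem_erase hi')]
  simp_rw [h2, ← Finset.mul_sum] at h
  rw [one_div, inv_pow, inv_mul_eq_one₀ (by positivity)] at h
  exact h.symm

end BlackboardProtocol

/-! ### Integrals over bins, and sampling laws -/

lemma iUnion_bin (d : ℕ) [NeZero d] : ⋃ j, {x | binIndex d x = j} = Set.univ := by
  ext x; simp

lemma pairwise_disjoint_bin (d : ℕ) [NeZero d] :
    Pairwise (Function.onFun Disjoint fun j => {x | binIndex d x = j}) := by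
  intro i j hij
  rw [Function.onFun, Set.disjoint_left]
  rintro x rfl h
  exact hij h

lemma integral_eq_sum_bin (d : ℕ) [NeZero d] {g : unitInterval → ℝ} (hg : Integrable g) :
    ∫ x, g x = ∑ j, ∫ x in {x | binIndex d x = j}, g x := by
  rw [← setIntegral_univ, ← iUnion_bin d]
  exact integral_iUnion_fintype (measurableSet_bin d) (pairwise_disjoint_bin d)
    fun j => hg.integrableOn

lemma lintegral_eq_sum_bin (d : ℕ) [NeZero d] (g : unitInterval → ℝ≥0∞) :
    ∫⁻ x, g x = ∑ j, ∫⁻ x in {x | binIndex d x = j}, g x := by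
  rw [← setLIntegral_univ, ← iUnion_bin d,
    lintegral_iUnion (measurableSet_bin d) (pairwise_disjoint_bin d), tsum_fintype]

lemma eLpNorm_two_sq {α : Type*} [MeasurableSpace α] (μ : Measure α) (g : α → ℝ) :
    eLpNorm g 2 μ ^ 2 = ∫⁻ x, ENNReal.ofReal (g x ^ 2) ∂μ := by
  have h := eLpNorm_nnreal_pow_eq_lintegral (μ := μ) (f := g) (p := 2) (by norm_num)
  simp only [NNReal.coe_ofNat, ENNReal.coe_ofNat, ENNReal.rpow_ofNat] at h
  rw [h]
  refine lintegral_congr fun x => ?_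
  rw [← ofReal_norm, ← ENNReal.ofReal_pow (norm_nonneg _), Real.norm_eq_abs, sq_abs]

lemma continuous_of_mem_holderDensities {s L : ℝ} (hs : 0 < s) {f : unitInterval → ℝ}
    (hf : f ∈ holderDensities s L) : Continuous f := by
  rw [continuous_iff_continuousAt]
  intro x
  rw [ContinuousAt, tendsto_iff_dist_tendsto_zero]
  have hc : Continuous fun y : unitInterval => L * |(y : ℝ) - x| ^ s :=
    continuous_const.mul (Continuous.rpow_const (by fun_prop) fun _ => Or.inr hs.le)
  have h0 : Filter.Tendsto (fun y : unitInterval => L * |(y : ℝ) - x| ^ s) (nhds x) (nhds 0) := by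
    have := hc.tendsto x
    simpa [Real.zero_rpow hs.ne'] using this
  exact squeeze_zero (fun _ => dist_nonneg) (fun y => hf.2.2 y x) h0

lemma Continuous.integrable_unitInterval {f : unitInterval → ℝ} (hf : Continuous f) :
    Integrable f :=
  hf.integrable_of_hasCompactSupport (HasCompactSupport.of_compactSpace f)

lemma isProbabilityMeasure_sampleLaw {f : unitInterval → ℝ} (hf : Integrable f)
    (hf0 : ∀ x, 0 ≤ f x) (hf1 : ∫ x, f x = 1) : IsProbabilityMeasure (sampleLaw f) := by
  constructor
  rw [sampleLaw, withDensity_apply _ MeasurableSet.univ, setLIntegral_univ,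
    ← ofReal_integral_eq_lintegral_ofReal hf (.of_forall hf0), hf1, ENNReal.ofReal_one]

lemma integral_sampleLaw {f : unitInterval → ℝ} (hf : Measurable f) (hf0 : ∀ x, 0 ≤ f x)
    (g : unitInterval → ℝ) : ∫ x, g x ∂(sampleLaw f) = ∫ x, g x * f x := by
  rw [sampleLaw, integral_withDensity_eq_integral_toReal_smul (by fun_prop)
    (.of_forall fun _ => ENNReal.ofReal_lt_top)]
  refine integral_congr_ae (.of_forall fun x => ?_)
  simp only [ENNReal.toReal_ofReal (hf0 x), smul_eq_mul, mul_comm]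

/-- The law of the transcript of a blackboard protocol when the samples have density `f`. -/
noncomputable def BlackboardProtocol.transcriptLaw {n k : ℕ}
    (P : BlackboardProtocol unitInterval n k) (f : unitInterval → ℝ)
    (y : Fin (n * k) → Bool) : ℝ :=
  ∏ i, ∫ u, P.nodeLikelihood i y u * f u

/-- For each transcript the estimation error does not depend on the samples, so only its probability
is integrated, and that factorizes by independence of the samples. -/
lemma BlackboardProtocol.l2Risk_eq {n k : ℕ} (P : BlackboardProtocol unitInterval n k)
    (fhat : (Fin (n * k) → Bool) → unitInterval → ℝ) {f : unitInterval → ℝ} (hf : Measurable f)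
    (hfi : Integrable f) (hf0 : ∀ x, 0 ≤ f x) (hf1 : ∫ x, f x = 1) :
    l2Risk P.transcriptProb fhat f = ∑ y, ENNReal.ofReal (P.transcriptLaw f y) *
      ∫⁻ u, ENNReal.ofReal ((f u - fhat y u) ^ 2) := by
  have := isProbabilityMeasure_sampleLaw hfi hf0 hf1
  have hm : ∀ y, Measurable fun x => P.transcriptProb x y := by
    intro y
    simp_rw [P.transcriptProb_eq_prod]
    refine Finset.measurable_prod _ fun i _ => ?_
    exact (P.measurable_nodeLikelihood i y).comp (measurable_pi_apply i)
  rw [l2Risk, lintegral_finsetSum _ fun y _ => (hm y).ennreal_ofReal.mul_const _]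
  refine Finset.sum_congr rfl fun y _ => ?_
  rw [lintegral_mul_const _ (hm y).ennreal_ofReal, eLpNorm_two_sq]
  congr 1
  have hi : ∀ i, Integrable (P.nodeLikelihood i y) (sampleLaw f) := fun i => by
    simpa using P.integrable_nodeLikelihood_mul i y (integrable_const (μ := sampleLaw f) (1 : ℝ))
  rw [← ofReal_integral_eq_lintegral_ofReal]
  · simp_rw [P.transcriptProb_eq_prod]
    rw [integral_fintype_prod_eq_prod (fun i u => P.nodeLikelihood i y u)]
    simp_rw [integral_sampleLaw hf hf0]
    rfl
  · simp_rw [P.transcriptProb_eq_prod]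
    exact Integrable.fintype_prod hi
  · refine .of_forall fun x => ?_
    simp only [P.transcriptProb_eq_prod]
    exact Finset.prod_nonneg fun i _ => P.nodeLikelihood_nonneg i y _

/-! ### Affinity of two transcript laws -/

/-- From `log (1 + w) ≥ w / (1 + w)`, what remains is `w² (1 + 2w) ≥ 0`. -/
lemma sub_two_mul_sq_le_log {w : ℝ} (hw : |w| ≤ 1 / 2) : w - 2 * w ^ 2 ≤ Real.log (1 + w) := by
  have h := abs_le.1 hw
  have hpos : 0 < 1 + w := by linarith
  refine le_trans ?_ (Real.one_sub_inv_le_log_of_pos hpos)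
  rw [le_sub_iff_add_le, ← le_sub_iff_add_le', inv_le_iff_one_le_mul₀ hpos]
  nlinarith [mul_nonneg (sq_nonneg w) (by linarith : 0 ≤ 1 + 2 * w)]

/-- First-order lower bound for the geometric mean of two products with comparable factors. -/
lemma prod_add_sum_le_sqrt {ι : Type*} [Fintype ι] [DecidableEq ι] (a δ : ι → ℝ)
    (ha : ∀ i, 0 ≤ a i) (hδ : ∀ i, |δ i| ≤ a i / 2) :
    ∏ i, a i + ∑ i, (∏ j ∈ Finset.univ.erase i, a j) * (δ i / 2 - δ i ^ 2 / a i)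
      ≤ √((∏ i, a i) * ∏ i, (a i + δ i)) := by
  -- If some `a i` vanishes, so does `δ i`, and both sides are zero, with `0 / 0 = 0` in the `i`-th
  -- term.
  by_cases h0 : ∃ i, a i = 0
  · obtain ⟨i, hi⟩ := h0
    have hδi : δ i = 0 := by
      have := hδ i
      rw [hi, zero_div] at this
      exact abs_nonpos_iff.1 this
    have hs : ∀ j, (∏ l ∈ Finset.univ.erase j, a l) * (δ j / 2 - δ j ^ 2 / a j) = 0 := by
      intro j
      by_cases hj : j = i
      · subst hj; simp [hδi]
      · rw [Finset.prod_eq_zero (Finset.mem_erase.2 ⟨Ne.symm hj, Finset.mem_univ i⟩) hi, zero_mul]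
    simp [hs, Finset.prod_eq_zero (Finset.mem_univ i) hi]
  · push Not at h0
    have hpos : ∀ i, 0 < a i := fun i => lt_of_le_of_ne (ha i) (h0 i).symm
    set w : ι → ℝ := fun i => δ i / a i with hw
    have hδw : ∀ i, δ i = a i * w i := fun i => by rw [hw]; field_simp [(hpos i).ne']
    have hw2 : ∀ i, |w i| ≤ 1 / 2 := fun i => by
      rw [hw, abs_div, abs_of_pos (hpos i), div_le_iff₀ (hpos i)]
      linarith [hδ i]
    have hw1 : ∀ i, 0 < 1 + w i := fun i => by linarith [(abs_le.1 (hw2 i)).1]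
    have hA : 0 < ∏ i, a i := Finset.prod_pos fun i _ => hpos i
    have hL : ∀ i, (∏ j ∈ Finset.univ.erase i, a j) * (δ i / 2 - δ i ^ 2 / a i)
        = (∏ i, a i) * ((w i - 2 * w i ^ 2) / 2) := fun i => by
      rw [← Finset.mul_prod_erase _ a (Finset.mem_univ i), hδw i]
      field_simp [(hpos i).ne']
    have hR : (∏ i, a i) * ∏ i, (a i + δ i) = (∏ i, a i) ^ 2 * ∏ i, (1 + w i) := by
      have : ∀ i, a i + δ i = a i * (1 + w i) := fun i => by rw [hδw i]; ring
      simp_rw [this, Finset.prod_mul_distrib]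
      ring
    have hexp : ∏ i, (1 + w i) = Real.exp (∑ i, Real.log (1 + w i)) := by
      rw [Real.exp_sum]
      exact Finset.prod_congr rfl fun i _ => (Real.exp_log (hw1 i)).symm
    simp_rw [hL]
    rw [hR, Real.sqrt_mul (sq_nonneg _), Real.sqrt_sq hA.le, ← Finset.mul_sum, ← mul_one_add,
      hexp, ← Real.exp_half]
    -- After division by `∏ a`, the geometric mean is `exp (½ ∑ log (1 + w))`, which `1 + x ≤ exp x`
    -- bounds from below.
    refine mul_le_mul_of_nonneg_left ?_ hA.le
    calc 1 + ∑ i, (w i - 2 * w i ^ 2) / 2 ≤ (∑ i, Real.log (1 + w i)) / 2 + 1 := by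
          rw [add_comm, Finset.sum_div]
          gcongr with i
          exact sub_two_mul_sq_le_log (hw2 i)
      _ ≤ _ := Real.add_one_le_exp _

namespace BlackboardProtocol

variable {n k : ℕ} (P : BlackboardProtocol unitInterval n k)

/-- The Bhattacharyya coefficient of the transcript laws under `f` and `g`. -/
lemma one_sub_le_sum_sqrt {f g : unitInterval → ℝ} (hf : Integrable f) (hg : Integrable g)
    (hf0 : ∀ x, 0 ≤ f x) (hf1 : ∫ x, f x = 1) (hg1 : ∫ x, g x = 1)
    (hfg : ∀ i y, |∫ u, P.nodeLikelihood i y u * (g u - f u)|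
      ≤ (∫ u, P.nodeLikelihood i y u * f u) / 2) :
    1 - ∑ i, ∑ y, (∏ j ∈ Finset.univ.erase i, ∫ u, P.nodeLikelihood j y u * f u) *
        ((∫ u, P.nodeLikelihood i y u * (g u - f u)) ^ 2 / ∫ u, P.nodeLikelihood i y u * f u)
      ≤ ∑ y, √(P.transcriptLaw f y * P.transcriptLaw g y) := by
  set a : (Fin (n * k) → Bool) → Fin n → ℝ := fun y i => ∫ u, P.nodeLikelihood i y u * f u with ha
  set δ : (Fin (n * k) → Bool) → Fin n → ℝ :=
    fun y i => ∫ u, P.nodeLikelihood i y u * (g u - f u) with hδ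
  have hgf : Integrable fun u => g u - f u := hg.sub hf
  have hg' : ∀ y i, ∫ u, P.nodeLikelihood i y u * g u = a y i + δ y i := fun y i => by
    rw [ha, hδ]
    simp only
    rw [← integral_add (P.integrable_nodeLikelihood_mul i y hf)
      (P.integrable_nodeLikelihood_mul i y hgf)]
    congr 1; ext u; ring
  have hsum : ∑ y, ∏ i, a y i = 1 := by
    have := P.sum_prod_integral (fun _ => f) fun _ => hf
    simpa only [hf1, Finset.prod_const_one] using this
  -- The first-order terms cancel: this is the total transcript mass when node `i` has the signed
  -- density `g - f`, whose integral is zero.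
  have hzero : ∀ i, ∑ y, (∏ j ∈ Finset.univ.erase i, a y j) * δ y i = 0 := by
    intro i
    have h := P.sum_prod_integral (Function.update (fun _ => f) i fun u => g u - f u) (by
      intro j
      by_cases hj : j = i
      · subst hj; simpa using hgf
      · simpa [hj] using hf)
    rw [← Finset.mul_prod_erase _ _ (Finset.mem_univ i)] at h
    simp only [Function.update_self, integral_sub hg hf, hf1, hg1, sub_self, zero_mul] at h
    rw [← h]
    refine Finset.sum_congr rfl fun y _ => ?_
    rw [← Finset.mul_prod_erase _ _ (Finset.mem_univ i), mul_comm, Function.update_self]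
    congr 1
    refine Finset.prod_congr rfl fun j hj => ?_
    rw [Function.update_of_ne (Finset.ne_of_mem_erase hj)]
  have key : ∀ y, ∏ i, a y i + ∑ i, (∏ j ∈ Finset.univ.erase i, a y j) *
      (δ y i / 2 - δ y i ^ 2 / a y i) ≤ √(P.transcriptLaw f y * P.transcriptLaw g y) := by
    intro y
    have h := prod_add_sum_le_sqrt (a y) (δ y)
      (fun i => integral_nonneg fun u => mul_nonneg (P.nodeLikelihood_nonneg i y u) (hf0 u))
      fun i => hfg i y
    simp only [transcriptLaw, hg']
    exact h
  refine le_trans (le_of_eq ?_) (Finset.sum_le_sum fun y _ => key y)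
  rw [Finset.sum_add_distrib, hsum, Finset.sum_comm (s := Finset.univ (α := Fin (n * k) → Bool)),
    sub_eq_add_neg, ← Finset.sum_neg_distrib]
  congr 1
  refine Finset.sum_congr rfl fun i _ => ?_
  have h2 : ∀ y, (∏ j ∈ Finset.univ.erase i, a y j) * (δ y i / 2 - δ y i ^ 2 / a y i)
      = (1 / 2) * ((∏ j ∈ Finset.univ.erase i, a y j) * δ y i)
        - (∏ j ∈ Finset.univ.erase i, a y j) * (δ y i ^ 2 / a y i) := fun y => by ring
  simp_rw [h2]
  rw [Finset.sum_sub_distrib, ← Finset.mul_sum, hzero i]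
  ring

end BlackboardProtocol

/-! ### The perturbed densities -/

/-- The uniform density perturbed in each of `d` bins by a sine wave of amplitude `ε`, with signs
given by `θ`. -/
noncomputable def perturbedDensity (d : ℕ) [NeZero d] (ε : ℝ) (θ : Fin d → Bool)
    (x : unitInterval) : ℝ :=
  1 + ε * ((if θ (binIndex d x) then 1 else -1) * Real.sin (2 * Real.pi * d * x))

/-- The sign vector `θ` with its `j`-th entry flipped. -/
def flipAt {d : ℕ} (j : Fin d) (θ : Fin d → Bool) : Fin d → Bool :=
  Function.update θ j (!θ j)

lemma flipAt_involutive {d : ℕ} (j : Fin d) : Function.Involutive (flipAt j) := by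
  intro θ
  simp [flipAt]

section perturbedDensity

variable (d : ℕ) [NeZero d] {ε : ℝ} (θ : Fin d → Bool)

lemma measurable_perturbedDensity : Measurable (perturbedDensity d ε θ) := by
  have h : Measurable fun x => (if θ (binIndex d x) then (1 : ℝ) else -1) :=
    (measurable_of_countable fun j => (if θ j then (1 : ℝ) else -1)).comp (measurable_binIndex d)
  unfold perturbedDensity
  fun_prop

lemma abs_sign_mul_sin_le (x : unitInterval) :
    |(if θ (binIndex d x) then (1 : ℝ) else -1) * Real.sin (2 * Real.pi * d * x)| ≤ 1 := by
  rw [abs_mul]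
  have : |(if θ (binIndex d x) then (1 : ℝ) else -1)| = 1 := by split_ifs <;> simp
  rw [this, one_mul]
  exact Real.abs_sin_le_one _

lemma perturbedDensity_mem_Icc (hε : 0 ≤ ε) (x : unitInterval) :
    perturbedDensity d ε θ x ∈ Set.Icc (1 - ε) (1 + ε) := by
  have h := abs_le.1 (abs_sign_mul_sin_le d θ x)
  constructor <;> unfold perturbedDensity <;> nlinarith

lemma integrable_perturbedDensity (hε : 0 ≤ ε) : Integrable (perturbedDensity d ε θ) := by
  refine Integrable.of_bound (measurable_perturbedDensity d θ).aestronglyMeasurable (1 + ε)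
    (.of_forall fun x => ?_)
  have := perturbedDensity_mem_Icc d θ hε x
  rw [Real.norm_eq_abs, abs_le]
  constructor <;> linarith [this.1, this.2]

lemma integral_perturbedDensity (hε : 0 ≤ ε) : ∫ x, perturbedDensity d ε θ x = 1 := by
  have hd : (d : ℝ) ≠ 0 := by exact_mod_cast NeZero.ne d
  have h : ∀ j, ∫ x in {x | binIndex d x = j}, perturbedDensity d ε θ x = 1 / d := by
    intro j
    have h1 : ∫ x in {x | binIndex d x = j}, perturbedDensity d ε θ x =
        ∫ x in {x | binIndex d x = j},
          (1 + ε * (if θ j then (1 : ℝ) else -1) * Real.sin (2 * Real.pi * d * x)) := by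
      refine setIntegral_congr_fun (measurableSet_bin d j) fun x hx => ?_
      have hx : binIndex d x = j := hx
      simp only [perturbedDensity, hx]
      ring
    have hi : IntegrableOn (fun x : unitInterval =>
        ε * (if θ j then (1 : ℝ) else -1) * Real.sin (2 * Real.pi * d * x))
        {x | binIndex d x = j} :=
      (Continuous.integrable_unitInterval (by fun_prop)).integrableOn
    rw [h1, integral_add (integrable_const _) hi, integral_const_mul, integral_sin_bin]
    simp [volume_real_bin]
  rw [integral_eq_sum_bin d (integrable_perturbedDensity d θ hε)]
  simp only [h, Finset.sum_const, Finset.card_univ, Fintype.card_fin, nsmul_eq_mul]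
  field_simp

/-- The wave vanishes at the bin boundaries, so sign changes do not spoil the Lipschitz bound: for
points in different bins, compare both with the left end `m / d` of the bin of the right-hand point.
-/
lemma abs_sign_mul_sin_sub_le (x y : unitInterval) :
    |(if θ (binIndex d x) then (1 : ℝ) else -1) * Real.sin (2 * Real.pi * d * x)
      - (if θ (binIndex d y) then (1 : ℝ) else -1) * Real.sin (2 * Real.pi * d * y)|
      ≤ 2 * Real.pi * (d * |(x : ℝ) - y|) := by
  have hpi := Real.pi_pos
  have hlip : ∀ u v : ℝ, |Real.sin u - Real.sin v| ≤ |u - v| := fun u v => by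
    have := Real.lipschitzWith_sin.dist_le_mul u v
    simpa [Real.dist_eq] using this
  have hsgn : ∀ b : Bool, |(if b then (1 : ℝ) else -1)| = 1 := fun b => by cases b <;> simp
  have hd : (0 : ℝ) ≤ d := Nat.cast_nonneg d
  wlog hle : binIndex d x ≤ binIndex d y generalizing x y with H
  · have := H y x (le_of_not_ge hle)
    rwa [abs_sub_comm, abs_sub_comm (x : ℝ)]
  rcases hle.eq_or_lt with heq | hlt
  · rw [heq, ← mul_sub, abs_mul, hsgn, one_mul]
    refine (hlip _ _).trans (le_of_eq ?_)
    rw [← mul_sub, abs_mul, abs_of_nonneg (by positivity : 0 ≤ 2 * Real.pi * d)]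
    ring
  · set m : ℕ := (binIndex d y).val with hm
    have h1 : d * (x : ℝ) ≤ m := by
      refine (mul_le_binIndex_add_one d x).trans ?_
      exact_mod_cast hlt
    have h2 : (m : ℝ) ≤ d * y := binIndex_le_mul d y
    have hsin : Real.sin (2 * Real.pi * m) = 0 := by
      have := Real.sin_nat_mul_pi (2 * m)
      push_cast at this
      rw [← this]; ring_nf
    have h3 : |Real.sin (2 * Real.pi * d * x)| ≤ 2 * Real.pi * (m - d * x) := by
      have := hlip (2 * Real.pi * d * x) (2 * Real.pi * m)
      have e : 2 * Real.pi * d * x - 2 * Real.pi * m = -(2 * Real.pi * (m - d * x)) := by ring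
      rwa [hsin, sub_zero, e, abs_neg,
        abs_of_nonneg (mul_nonneg (by positivity) (sub_nonneg.2 h1))] at this
    have h4 : |Real.sin (2 * Real.pi * d * y)| ≤ 2 * Real.pi * (d * y - m) := by
      have := hlip (2 * Real.pi * d * y) (2 * Real.pi * m)
      have e : 2 * Real.pi * d * y - 2 * Real.pi * m = 2 * Real.pi * (d * y - m) := by ring
      rwa [hsin, sub_zero, e,
        abs_of_nonneg (mul_nonneg (by positivity) (sub_nonneg.2 h2))] at this
    refine (abs_sub _ _).trans ?_
    rw [abs_mul, abs_mul, hsgn, hsgn, one_mul, one_mul]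
    have h5 : d * ((y : ℝ) - x) ≤ d * |(x : ℝ) - y| := by
      rw [abs_sub_comm]
      exact mul_le_mul_of_nonneg_left (le_abs_self _) hd
    nlinarith

lemma perturbedDensity_mem_holderDensities {s L : ℝ} (hs0 : 0 < s) (hs1 : s ≤ 1) (hε : 0 ≤ ε)
    (hε1 : ε ≤ 1) (hεL : ε * 8 ≤ L * (d : ℝ) ^ (-s)) :
    perturbedDensity d ε θ ∈ holderDensities s L := by
  have hd : (0 : ℝ) < d := by exact_mod_cast NeZero.pos d
  refine ⟨fun x => ?_, integral_perturbedDensity d θ hε, fun x y => ?_⟩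
  · linarith [(perturbedDensity_mem_Icc d θ hε x).1]
  · have h1 := abs_sign_mul_sin_sub_le d θ x y
    have h2 : |(if θ (binIndex d x) then (1 : ℝ) else -1) * Real.sin (2 * Real.pi * d * x)
      - (if θ (binIndex d y) then (1 : ℝ) else -1) * Real.sin (2 * Real.pi * d * y)| ≤ 2 :=
      (abs_sub _ _).trans (by
        linarith [abs_sign_mul_sin_le d θ x, abs_sign_mul_sin_le d θ y])
    set r : ℝ := d * |(x : ℝ) - y| with hr
    have hr0 : 0 ≤ r := by positivity
    -- The difference is at most `2πr` and at most `2`. For `r ≤ 1` use `2π < 8` and `r ≤ r^s`,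
    -- which needs `s ≤ 1`; for `r ≥ 1` use `r^s ≥ 1`.
    have h3 : |(if θ (binIndex d x) then (1 : ℝ) else -1) * Real.sin (2 * Real.pi * d * x)
      - (if θ (binIndex d y) then (1 : ℝ) else -1) * Real.sin (2 * Real.pi * d * y)|
        ≤ 8 * r ^ s := by
      rcases le_total r 1 with hr1 | hr1
      · have : r ≤ r ^ s := by
          rcases hr0.eq_or_lt with h0 | h0
          · rw [← h0, Real.zero_rpow hs0.ne']
          · simpa using Real.rpow_le_rpow_of_exponent_ge h0 hr1 hs1
        have := Real.pi_lt_four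
        nlinarith
      · have := Real.one_le_rpow hr1 hs0.le
        linarith
    have h4 : perturbedDensity d ε θ x - perturbedDensity d ε θ y = ε *
        ((if θ (binIndex d x) then (1 : ℝ) else -1) * Real.sin (2 * Real.pi * d * x)
      - (if θ (binIndex d y) then (1 : ℝ) else -1) * Real.sin (2 * Real.pi * d * y)) := by
      unfold perturbedDensity; ring
    rw [h4, abs_mul, abs_of_nonneg hε]
    calc _ ≤ ε * (8 * r ^ s) := mul_le_mul_of_nonneg_left h3 hε
      _ = (ε * 8) * r ^ s := by ring
      _ ≤ (L * (d : ℝ) ^ (-s)) * r ^ s :=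
        mul_le_mul_of_nonneg_right hεL (Real.rpow_nonneg hr0 s)
      _ = L * |(x : ℝ) - y| ^ s := by
        rw [hr, Real.mul_rpow hd.le (abs_nonneg _), Real.rpow_neg hd.le]
        have := Real.rpow_pos_of_pos hd s
        field_simp

variable {d}

lemma perturbedDensity_flipAt_of_ne {j : Fin d} {x : unitInterval} (h : binIndex d x ≠ j) :
    perturbedDensity d ε (flipAt j θ) x = perturbedDensity d ε θ x := by
  simp [perturbedDensity, flipAt, h]

lemma perturbedDensity_flipAt_sub_sq {j : Fin d} {x : unitInterval} (h : binIndex d x = j) :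
    (perturbedDensity d ε θ x - perturbedDensity d ε (flipAt j θ) x) ^ 2
      = 4 * ε ^ 2 * Real.sin (2 * Real.pi * d * x) ^ 2 := by
  subst h
  cases hb : θ (binIndex d x) <;> simp [perturbedDensity, flipAt, hb] <;> ring

lemma abs_perturbedDensity_flipAt_sub_le (hε : 0 ≤ ε) (j : Fin d) (x : unitInterval) :
    |perturbedDensity d ε (flipAt j θ) x - perturbedDensity d ε θ x|
      ≤ {x | binIndex d x = j}.indicator (fun _ => 2 * ε) x := by
  by_cases h : binIndex d x = j
  · rw [Set.indicator_of_mem (by exact h)]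
    have h1 := perturbedDensity_mem_Icc d θ hε x
    have h2 := perturbedDensity_mem_Icc d (flipAt j θ) hε x
    rw [abs_le]
    constructor <;> linarith [h1.1, h1.2, h2.1, h2.2]
  · rw [perturbedDensity_flipAt_of_ne θ h, Set.indicator_of_notMem (by exact h)]
    simp

end perturbedDensity

/-! ### Information carried by a transcript about the signs -/

section information

variable {d : ℕ} [NeZero d] {ε : ℝ} (θ : Fin d → Bool) {q : unitInterval → ℝ}

lemma integrable_of_mem_Icc (hq : Measurable q) (hq01 : ∀ u, q u ∈ Set.Icc (0 : ℝ) 1) :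
    Integrable q := by
  refine Integrable.of_bound hq.aestronglyMeasurable 1 (.of_forall fun u => ?_)
  rw [Real.norm_of_nonneg (hq01 u).1]
  exact (hq01 u).2

/-- The density is at least `7/8`, so Lebesgue mass is controlled by probability. -/
lemma integral_le_two_mul_integral_perturbedDensity (hq : Measurable q)
    (hq01 : ∀ u, q u ∈ Set.Icc (0 : ℝ) 1) (hε : 0 ≤ ε) (hε1 : ε ≤ 1 / 8) :
    ∫ u, q u ≤ 2 * ∫ u, q u * perturbedDensity d ε θ u := by
  have hqi := integrable_of_mem_Icc hq hq01
  rw [← integral_const_mul]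
  refine integral_mono hqi ?_ fun u => ?_
  · refine Integrable.const_mul ?_ 2
    refine (integrable_perturbedDensity d θ hε).bdd_mul (c := 1) hq.aestronglyMeasurable
      (.of_forall fun u => ?_)
    rw [Real.norm_of_nonneg (hq01 u).1]
    exact (hq01 u).2
  · have := (perturbedDensity_mem_Icc d θ hε u).1
    have := (hq01 u).1
    simp only
    nlinarith

lemma abs_integral_flipAt_sub_le (hq : Measurable q) (hq01 : ∀ u, q u ∈ Set.Icc (0 : ℝ) 1)
    (hε : 0 ≤ ε) (j : Fin d) :
    |∫ u, q u * (perturbedDensity d ε (flipAt j θ) u - perturbedDensity d ε θ u)|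
      ≤ 2 * ε * ∫ u in {x | binIndex d x = j}, q u := by
  have hqi := integrable_of_mem_Icc hq hq01
  refine (abs_integral_le_integral_abs).trans ?_
  rw [← integral_const_mul, ← integral_indicator (measurableSet_bin d j)]
  refine integral_mono_of_nonneg (.of_forall fun u => abs_nonneg _)
    ((hqi.const_mul _).indicator (measurableSet_bin d j)) (.of_forall fun u => ?_)
  simp only [abs_mul, abs_of_nonneg (hq01 u).1]
  have h := mul_le_mul_of_nonneg_left (abs_perturbedDensity_flipAt_sub_le θ hε j u) (hq01 u).1
  refine h.trans (le_of_eq ?_)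
  by_cases hu : binIndex d u = j
  · rw [Set.indicator_of_mem (by exact hu), Set.indicator_of_mem (by exact hu)]; ring
  · rw [Set.indicator_of_notMem (by exact hu), Set.indicator_of_notMem (by exact hu), mul_zero]

lemma setIntegral_bin_nonneg (hq01 : ∀ u, q u ∈ Set.Icc (0 : ℝ) 1) (j : Fin d) :
    0 ≤ ∫ u in {x | binIndex d x = j}, q u :=
  setIntegral_nonneg (measurableSet_bin d j) fun u _ => (hq01 u).1

lemma setIntegral_bin_le (hq : Measurable q) (hq01 : ∀ u, q u ∈ Set.Icc (0 : ℝ) 1) (j : Fin d) :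
    ∫ u in {x | binIndex d x = j}, q u ≤ 1 / d := by
  have hqi := integrable_of_mem_Icc hq hq01
  rw [← volume_real_bin d j]
  calc ∫ u in {x | binIndex d x = j}, q u ≤ ∫ u in {x | binIndex d x = j}, (1 : ℝ) :=
        setIntegral_mono hqi.integrableOn (integrable_const _) fun u => (hq01 u).2
    _ = _ := by simp

/-- The comparability hypothesis of `prod_add_sum_le_sqrt`: the change is at most `2ε · 2a`, and `4ε
≤ 1/2`. -/
lemma abs_integral_flipAt_sub_le_half (hq : Measurable q) (hq01 : ∀ u, q u ∈ Set.Icc (0 : ℝ) 1)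
    (hε : 0 ≤ ε) (hε1 : ε ≤ 1 / 8) (j : Fin d) :
    |∫ u, q u * (perturbedDensity d ε (flipAt j θ) u - perturbedDensity d ε θ u)|
      ≤ (∫ u, q u * perturbedDensity d ε θ u) / 2 := by
  have h1 := abs_integral_flipAt_sub_le θ hq hq01 hε j
  have h2 := integral_le_two_mul_integral_perturbedDensity θ hq hq01 hε hε1
  have h3 : ∫ u in {x | binIndex d x = j}, q u ≤ ∫ u, q u :=
    setIntegral_le_integral (integrable_of_mem_Icc hq hq01) (.of_forall fun u => (hq01 u).1)
  have h4 := setIntegral_bin_nonneg hq01 j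
  nlinarith

/-- The squared conditional scores of all signs, bounded without and with the message size. -/
lemma sum_sq_integral_flipAt_sub_le (hq : Measurable q) (hq01 : ∀ u, q u ∈ Set.Icc (0 : ℝ) 1)
    (hε : 0 ≤ ε) (hε1 : ε ≤ 1 / 8) :
    (∑ j, (∫ u, q u * (perturbedDensity d ε (flipAt j θ) u - perturbedDensity d ε θ u)) ^ 2 /
        ∫ u, q u * perturbedDensity d ε θ u) ≤ 16 * ε ^ 2 * ∫ u, q u * perturbedDensity d ε θ u ∧
    (∑ j, (∫ u, q u * (perturbedDensity d ε (flipAt j θ) u - perturbedDensity d ε θ u)) ^ 2 /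
        ∫ u, q u * perturbedDensity d ε θ u) ≤ 8 * ε ^ 2 / d := by
  have hd : (0 : ℝ) < d := by exact_mod_cast NeZero.pos d
  set a := ∫ u, q u * perturbedDensity d ε θ u with ha
  set m : Fin d → ℝ := fun j => ∫ u in {x | binIndex d x = j}, q u with hm
  have hm0 : ∀ j, 0 ≤ m j := setIntegral_bin_nonneg hq01
  have hmd : ∀ j, m j ≤ 1 / d := setIntegral_bin_le hq hq01
  have hsum : ∑ j, m j ≤ 2 * a := by
    rw [← integral_eq_sum_bin d (integrable_of_mem_Icc hq hq01)]
    exact integral_le_two_mul_integral_perturbedDensity θ hq hq01 hε hε1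
  have hsum0 : 0 ≤ ∑ j, m j := Finset.sum_nonneg fun j _ => hm0 j
  have ha0 : 0 ≤ a := by linarith
  have hδ : ∀ j, (∫ u, q u * (perturbedDensity d ε (flipAt j θ) u - perturbedDensity d ε θ u)) ^ 2
      ≤ 4 * ε ^ 2 * m j ^ 2 := by
    intro j
    have h := abs_integral_flipAt_sub_le θ hq hq01 hε j
    rw [← sq_abs]
    calc _ ≤ (2 * ε * m j) ^ 2 := pow_le_pow_left₀ (abs_nonneg _) h 2
      _ = _ := by ring
  rw [← Finset.sum_div]
  have hδs := Finset.sum_le_sum fun j (_ : j ∈ Finset.univ) => hδ j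
  rw [← Finset.mul_sum] at hδs
  have hε2 := sq_nonneg ε
  -- When `a = 0` the quotients are zero by convention. Otherwise `∑ m_j²` is bounded by `(∑ m_j)²`
  -- for the first estimate and by `(max m_j) ∑ m_j` with `m_j ≤ 1/d` for the second.
  rcases ha0.eq_or_lt with h0 | h0
  · rw [← h0]
    simp only [div_zero, mul_zero, le_refl, true_and]
    positivity
  constructor
  · rw [div_le_iff₀ h0]
    have h1 : ∑ j, m j ^ 2 ≤ (2 * a) ^ 2 :=
      (Finset.sum_sq_le_sq_sum_of_nonneg fun j _ => hm0 j).trans (pow_le_pow_left₀ hsum0 hsum 2)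
    nlinarith
  · rw [div_le_iff₀ h0]
    have h1 : ∑ j, m j ^ 2 ≤ 1 / d * (2 * a) := by
      calc ∑ j, m j ^ 2 ≤ ∑ j, 1 / d * m j := by
            refine Finset.sum_le_sum fun j _ => ?_
            rw [sq]
            exact mul_le_mul_of_nonneg_right (hmd j) (hm0 j)
        _ = 1 / d * ∑ j, m j := by rw [Finset.mul_sum]
        _ ≤ _ := by gcongr
    calc _ ≤ 4 * ε ^ 2 * ∑ j, m j ^ 2 := hδs
      _ ≤ 4 * ε ^ 2 * (1 / d * (2 * a)) := by gcongr
      _ = _ := by ring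

end information

/-- Converts affinity into overlap. For `p ≤ q` it reads `4 √(pq) ≤ 5p + q`, a weak form of AM-GM
for `5p` and `q`. Summed over two probability laws, the subtracted term costs `1/2`. -/
lemma sqrt_mul_sub_le_min {p q : ℝ} (hp : 0 ≤ p) (hq : 0 ≤ q) :
    √(p * q) - (p + q) / 4 ≤ min p q := by
  wlog h : p ≤ q generalizing p q with H
  · rw [mul_comm, add_comm, min_comm]
    exact H hq hp (le_of_not_ge h)
  rw [min_eq_left h, sub_le_iff_le_add, Real.sqrt_le_left (by positivity)]
  nlinarith [sq_nonneg (5 * p - q), mul_nonneg hp hq, mul_nonneg hp (sub_nonneg.2 h)]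

namespace BlackboardProtocol

variable {n k : ℕ} (P : BlackboardProtocol unitInterval n k) {d : ℕ} [NeZero d] {ε : ℝ}

lemma transcriptLaw_nonneg {f : unitInterval → ℝ} (hf0 : ∀ x, 0 ≤ f x)
    (y : Fin (n * k) → Bool) : 0 ≤ P.transcriptLaw f y :=
  Finset.prod_nonneg fun i _ => integral_nonneg fun u =>
    mul_nonneg (P.nodeLikelihood_nonneg i y u) (hf0 u)

lemma sum_transcriptLaw {f : unitInterval → ℝ} (hf : Integrable f) (hf1 : ∫ x, f x = 1) :
    ∑ y, P.transcriptLaw f y = 1 := by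
  have := P.sum_prod_integral (fun _ => f) fun _ => hf
  simpa only [transcriptLaw, hf1, Finset.prod_const_one] using this

/-- A single sign may well be revealed; only the sum over all signs is limited by the information of
the nodes, so the affinity is bounded on average over `j`. -/
lemma sum_affinity_ge (θ : Fin d → Bool) (hε : 0 ≤ ε) (hε1 : ε ≤ 1 / 8)
    (h : n * (16 * ε ^ 2) ≤ d / 4 ∨ n * (2 ^ k * (8 * ε ^ 2 / d)) ≤ (d : ℝ) / 4) :
    3 * (d : ℝ) / 4 ≤ ∑ j, ∑ y, √(P.transcriptLaw (perturbedDensity d ε θ) y *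
      P.transcriptLaw (perturbedDensity d ε (flipAt j θ)) y) := by
  have hq01 : ∀ i y u, P.nodeLikelihood i y u ∈ Set.Icc (0 : ℝ) 1 := fun i y u =>
    ⟨P.nodeLikelihood_nonneg i y u, P.nodeLikelihood_le_one i y u⟩
  have hint := integrable_perturbedDensity d θ hε
  have hone := integral_perturbedDensity d θ hε
  have hf0 : ∀ x, 0 ≤ perturbedDensity d ε θ x := fun x => by
    linarith [(perturbedDensity_mem_Icc d θ hε x).1]
  set a : Fin n → (Fin (n * k) → Bool) → ℝ :=
    fun i y => ∫ u, P.nodeLikelihood i y u * perturbedDensity d ε θ u with ha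
  have ha0 : ∀ i y, 0 ≤ a i y := fun i y =>
    integral_nonneg fun u => mul_nonneg (hq01 i y u).1 (hf0 u)
  set D : Fin n → (Fin (n * k) → Bool) → Fin d → ℝ := fun i y j =>
    (∫ u, P.nodeLikelihood i y u *
      (perturbedDensity d ε (flipAt j θ) u - perturbedDensity d ε θ u)) ^ 2 / a i y with hD
  have hBC : ∀ j, 1 - ∑ i, ∑ y, (∏ l ∈ Finset.univ.erase i, a l y) * D i y j
      ≤ ∑ y, √(P.transcriptLaw (perturbedDensity d ε θ) y *
        P.transcriptLaw (perturbedDensity d ε (flipAt j θ)) y) := fun j =>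
    P.one_sub_le_sum_sqrt hint (integrable_perturbedDensity d _ hε) hf0 hone
      (integral_perturbedDensity d _ hε) fun i y =>
        abs_integral_flipAt_sub_le_half θ (P.measurable_nodeLikelihood i y) (hq01 i y) hε hε1 j
  have hinfo := fun i y =>
    sum_sq_integral_flipAt_sub_le θ (P.measurable_nodeLikelihood i y) (hq01 i y) hε hε1
  have herase : ∀ i y, 0 ≤ ∏ l ∈ Finset.univ.erase i, a l y := fun i y =>
    Finset.prod_nonneg fun l _ => ha0 l y
  have htotal : ∑ i, ∑ y, (∏ l ∈ Finset.univ.erase i, a l y) * ∑ j, D i y j ≤ (d : ℝ) / 4 := by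
    rcases h with h | h
    · refine le_trans ?_ h
      have hi : ∀ i, ∑ y, (∏ l ∈ Finset.univ.erase i, a l y) * ∑ j, D i y j ≤ 16 * ε ^ 2 := by
        intro i
        calc _ ≤ ∑ y, (∏ l ∈ Finset.univ.erase i, a l y) * (16 * ε ^ 2 * a i y) :=
              Finset.sum_le_sum fun y _ =>
                mul_le_mul_of_nonneg_left (hinfo i y).1 (herase i y)
          -- The factor `a i y` completes the leave-one-out product to the transcript law, of mass
          -- one. In the second alternative this factor is missing and the mass is `2^k`.
          _ = ∑ y, 16 * ε ^ 2 * P.transcriptLaw (perturbedDensity d ε θ) y := by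
              refine Finset.sum_congr rfl fun y _ => ?_
              have := Finset.mul_prod_erase Finset.univ (fun l => a l y) (Finset.mem_univ i)
              rw [transcriptLaw, ← this]
              ring
          _ = 16 * ε ^ 2 := by
              rw [← Finset.mul_sum, P.sum_transcriptLaw hint hone, mul_one]
      calc _ ≤ ∑ _i : Fin n, 16 * ε ^ 2 := Finset.sum_le_sum fun i _ => hi i
        _ = _ := by simp
    · refine le_trans ?_ h
      have hi : ∀ i, ∑ y, (∏ l ∈ Finset.univ.erase i, a l y) * ∑ j, D i y j
          ≤ 2 ^ k * (8 * ε ^ 2 / d) := by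
        intro i
        calc _ ≤ ∑ y, (∏ l ∈ Finset.univ.erase i, a l y) * (8 * ε ^ 2 / d) :=
              Finset.sum_le_sum fun y _ =>
                mul_le_mul_of_nonneg_left (hinfo i y).2 (herase i y)
          _ = 2 ^ k * (8 * ε ^ 2 / d) := by
              rw [← Finset.sum_mul, P.sum_prod_erase_integral _ hint hone]
      calc _ ≤ ∑ _i : Fin n, 2 ^ k * (8 * ε ^ 2 / d) := Finset.sum_le_sum fun i _ => hi i
        _ = _ := by simp
  refine le_trans ?_ (Finset.sum_le_sum fun j _ => hBC j)
  rw [Finset.sum_sub_distrib, Finset.sum_comm]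
  have hswap : ∑ i, ∑ j, ∑ y, (∏ l ∈ Finset.univ.erase i, a l y) * D i y j
      = ∑ i, ∑ y, (∏ l ∈ Finset.univ.erase i, a l y) * ∑ j, D i y j := by
    refine Finset.sum_congr rfl fun i _ => ?_
    rw [Finset.sum_comm]
    simp_rw [Finset.mul_sum]
  rw [hswap]
  simp only [Finset.sum_const, Finset.card_univ, Fintype.card_fin, nsmul_eq_mul, mul_one]
  linarith

lemma sum_min_ge (θ : Fin d → Bool) (hε : 0 ≤ ε) (hε1 : ε ≤ 1 / 8)
    (h : n * (16 * ε ^ 2) ≤ d / 4 ∨ n * (2 ^ k * (8 * ε ^ 2 / d)) ≤ (d : ℝ) / 4) :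
    (d : ℝ) / 4 ≤ ∑ j, ∑ y, min (P.transcriptLaw (perturbedDensity d ε θ) y)
      (P.transcriptLaw (perturbedDensity d ε (flipAt j θ)) y) := by
  have hf0 : ∀ θ x, 0 ≤ perturbedDensity d ε θ x := fun θ x => by
    linarith [(perturbedDensity_mem_Icc d θ hε x).1]
  have hs : ∀ θ, ∑ y, P.transcriptLaw (perturbedDensity d ε θ) y = 1 := fun θ =>
    P.sum_transcriptLaw (integrable_perturbedDensity d θ hε) (integral_perturbedDensity d θ hε)
  have key : ∀ j, ∑ y, √(P.transcriptLaw (perturbedDensity d ε θ) y *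
      P.transcriptLaw (perturbedDensity d ε (flipAt j θ)) y) - 1 / 2
      ≤ ∑ y, min (P.transcriptLaw (perturbedDensity d ε θ) y)
      (P.transcriptLaw (perturbedDensity d ε (flipAt j θ)) y) := by
    intro j
    have := Finset.sum_le_sum fun y (_ : y ∈ Finset.univ) =>
      sqrt_mul_sub_le_min (P.transcriptLaw_nonneg (hf0 θ) y)
        (P.transcriptLaw_nonneg (hf0 (flipAt j θ)) y)
    rw [Finset.sum_sub_distrib, ← Finset.sum_div, Finset.sum_add_distrib, hs, hs] at this
    linarith
  refine le_trans ?_ (Finset.sum_le_sum fun j _ => key j)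
  rw [Finset.sum_sub_distrib]
  have := P.sum_affinity_ge θ hε hε1 h
  simp only [Finset.sum_const, Finset.card_univ, Fintype.card_fin, nsmul_eq_mul]
  linarith

end BlackboardProtocol

/-! ### The minimax lower bound -/

/-- No estimate is close to two densities with opposite signs on the `j`-th bin. -/
lemma le_lintegral_bin_add {d : ℕ} [NeZero d] (ε : ℝ) (θ : Fin d → Bool) (j : Fin d)
    {g : unitInterval → ℝ} (hg : AEStronglyMeasurable g volume) :
    ENNReal.ofReal (ε ^ 2 / d) ≤
      (∫⁻ u in {x | binIndex d x = j}, ENNReal.ofReal ((perturbedDensity d ε θ u - g u) ^ 2)) +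
      ∫⁻ u in {x | binIndex d x = j},
        ENNReal.ofReal ((perturbedDensity d ε (flipAt j θ) u - g u) ^ 2) := by
  have hm : AEMeasurable (fun u => ENNReal.ofReal ((perturbedDensity d ε θ u - g u) ^ 2))
      (volume.restrict {x | binIndex d x = j}) := by
    have := hg.aemeasurable.restrict (s := {x | binIndex d x = j})
    have := (measurable_perturbedDensity d (ε := ε) θ).aemeasurable
      (μ := volume.restrict {x | binIndex d x = j})
    fun_prop
  have hi : Integrable (fun u : unitInterval => 2 * ε ^ 2 * Real.sin (2 * Real.pi * d * u) ^ 2)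
      (volume.restrict {x | binIndex d x = j}) :=
    (Continuous.integrable_unitInterval (by fun_prop)).integrableOn
  rw [← lintegral_add_left' hm]
  -- Pointwise `a² + b² ≥ (a - b)² / 2`, and the two densities differ by `2ε |sin|` on the bin.
  have h : ε ^ 2 / d = ∫ u in {x | binIndex d x = j},
      2 * ε ^ 2 * Real.sin (2 * Real.pi * d * (u : unitInterval)) ^ 2 := by
    rw [integral_const_mul, integral_sin_sq_bin]
    ring
  rw [h, ofReal_integral_eq_lintegral_ofReal hi (.of_forall fun u => by positivity)]
  refine setLIntegral_mono' (measurableSet_bin d j) fun u hu => ?_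
  rw [← ENNReal.ofReal_add (sq_nonneg _) (sq_nonneg _)]
  refine ENNReal.ofReal_le_ofReal ?_
  have h1 := perturbedDensity_flipAt_sub_sq (ε := ε) θ (show binIndex d u = j from hu)
  nlinarith [sq_nonneg (perturbedDensity d ε θ u - g u
    + (perturbedDensity d ε (flipAt j θ) u - g u))]

namespace BlackboardProtocol

variable {n k : ℕ} (P : BlackboardProtocol unitInterval n k) {d : ℕ} [NeZero d] {ε : ℝ}

/-- Averaging the risk over all sign vectors. -/
lemma le_of_forall_l2Risk_le (fhat : (Fin (n * k) → Bool) → unitInterval → ℝ)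
    (hfhat : ∀ y, AEStronglyMeasurable (fhat y) volume) (hε : 0 ≤ ε) (hε1 : ε ≤ 1 / 8)
    (h : n * (16 * ε ^ 2) ≤ d / 4 ∨ n * (2 ^ k * (8 * ε ^ 2 / d)) ≤ (d : ℝ) / 4)
    {S : ℝ≥0∞} (hS : ∀ θ, l2Risk P.transcriptProb fhat (perturbedDensity d ε θ) ≤ S) :
    ENNReal.ofReal (ε ^ 2 / 8) ≤ S := by
  have hd : (0 : ℝ) < d := by exact_mod_cast NeZero.pos d
  have hf0 : ∀ θ x, 0 ≤ perturbedDensity d ε θ x := fun θ x => by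
    linarith [(perturbedDensity_mem_Icc d θ hε x).1]
  set p : (Fin d → Bool) → (Fin (n * k) → Bool) → ℝ :=
    fun θ y => P.transcriptLaw (perturbedDensity d ε θ) y with hp
  set e : (Fin d → Bool) → (Fin (n * k) → Bool) → Fin d → ℝ≥0∞ := fun θ y j =>
    ∫⁻ u in {x | binIndex d x = j}, ENNReal.ofReal ((perturbedDensity d ε θ u - fhat y u) ^ 2)
    with he
  have hp0 : ∀ θ y, 0 ≤ p θ y := fun θ y => P.transcriptLaw_nonneg (hf0 θ) y
  have hrisk : ∀ θ, l2Risk P.transcriptProb fhat (perturbedDensity d ε θ)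
      = ∑ j, ∑ y, ENNReal.ofReal (p θ y) * e θ y j := by
    intro θ
    rw [P.l2Risk_eq fhat (measurable_perturbedDensity d θ) (integrable_perturbedDensity d θ hε)
      (hf0 θ) (integral_perturbedDensity d θ hε), Finset.sum_comm]
    refine Finset.sum_congr rfl fun y _ => ?_
    rw [lintegral_eq_sum_bin d, Finset.mul_sum]
  have hpair : ∀ θ j y, ENNReal.ofReal (min (p θ y) (p (flipAt j θ) y)) *
      ENNReal.ofReal (ε ^ 2 / d) ≤ ENNReal.ofReal (p θ y) * e θ y j +
        ENNReal.ofReal (p (flipAt j θ) y) * e (flipAt j θ) y j := by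
    intro θ j y
    calc _ ≤ ENNReal.ofReal (min (p θ y) (p (flipAt j θ) y)) *
          (e θ y j + e (flipAt j θ) y j) := by
          gcongr
          exact le_lintegral_bin_add ε θ j (hfhat y)
      _ ≤ _ := by
          rw [mul_add]
          gcongr
          · exact min_le_left _ _
          · exact min_le_right _ _
  -- Flipping a sign permutes the cube, so after summation over `θ` both members of each pair
  -- contribute the same, giving the factor `2` below.
  have hflip : ∀ j, ∑ θ, ∑ y, ENNReal.ofReal (p (flipAt j θ) y) * e (flipAt j θ) y j
      = ∑ θ, ∑ y, ENNReal.ofReal (p θ y) * e θ y j := fun j =>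
    Equiv.sum_comp (flipAt_involutive j).toPerm
      fun θ => ∑ y, ENNReal.ofReal (p θ y) * e θ y j
  have hmin : ∀ θ, ENNReal.ofReal (ε ^ 2 / 4) ≤ ∑ j, ∑ y,
      ENNReal.ofReal (min (p θ y) (p (flipAt j θ) y)) * ENNReal.ofReal (ε ^ 2 / d) := by
    intro θ
    have h1 := P.sum_min_ge θ hε hε1 h
    have h2 : ∀ j, ∑ y, ENNReal.ofReal (min (p θ y) (p (flipAt j θ) y))
        = ENNReal.ofReal (∑ y, min (p θ y) (p (flipAt j θ) y)) := fun j =>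
      (ENNReal.ofReal_sum_of_nonneg fun y _ => le_min (hp0 _ _) (hp0 _ _)).symm
    simp_rw [← Finset.sum_mul, h2]
    rw [← ENNReal.ofReal_sum_of_nonneg fun j _ =>
        Finset.sum_nonneg fun y _ => le_min (hp0 _ _) (hp0 _ _),
      ← ENNReal.ofReal_mul' (by positivity)]
    refine ENNReal.ofReal_le_ofReal ?_
    calc ε ^ 2 / 4 = (d : ℝ) / 4 * (ε ^ 2 / d) := by field_simp
      _ ≤ _ := mul_le_mul_of_nonneg_right h1 (by positivity)
  have hcard : (2 ^ d : ℝ≥0∞) * ENNReal.ofReal (ε ^ 2 / 4) ≤ 2 ^ d * (2 * S) := by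
    calc (2 ^ d : ℝ≥0∞) * ENNReal.ofReal (ε ^ 2 / 4)
        = ∑ _θ : Fin d → Bool, ENNReal.ofReal (ε ^ 2 / 4) := by simp
      _ ≤ ∑ θ : Fin d → Bool, ∑ j, ∑ y, (ENNReal.ofReal (p θ y) * e θ y j +
          ENNReal.ofReal (p (flipAt j θ) y) * e (flipAt j θ) y j) :=
          Finset.sum_le_sum fun θ _ => (hmin θ).trans <|
            Finset.sum_le_sum fun j _ => Finset.sum_le_sum fun y _ => hpair θ j y
      _ = 2 * ∑ θ : Fin d → Bool, ∑ j, ∑ y, ENNReal.ofReal (p θ y) * e θ y j := by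
          simp_rw [Finset.sum_add_distrib]
          rw [two_mul]
          congr 1
          rw [Finset.sum_comm]
          simp_rw [hflip]
          rw [Finset.sum_comm]
      _ ≤ 2 * ∑ _θ : Fin d → Bool, S := by
          gcongr with θ
          exact (hrisk θ).symm.le.trans (hS θ)
      _ = _ := by simp; ring
  rw [ENNReal.mul_le_mul_iff_right (by positivity) (by finiteness)] at hcard
  have h4 : ENNReal.ofReal (ε ^ 2 / 4) = 2 * ENNReal.ofReal (ε ^ 2 / 8) := by
    rw [← ENNReal.ofReal_ofNat 2, ← ENNReal.ofReal_mul (by norm_num)]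
    congr 1; ring
  rw [h4, ENNReal.mul_le_mul_iff_right (by norm_num) (by norm_num)] at hcard
  exact hcard

lemma minimaxRate_le_iSup_l2Risk {s L : ℝ} (hs0 : 0 < s) (hs1 : s ≤ 1) (hL : 0 < L) (hn : 1 ≤ n)
    (fhat : (Fin (n * k) → Bool) → unitInterval → ℝ)
    (hfhat : ∀ y, AEStronglyMeasurable (fhat y) volume) :
    ENNReal.ofReal (min (1 / 8) (L / 8) ^ 2 / 32 * minimaxRate s n k) ≤
      ⨆ f ∈ holderDensities s L, l2Risk P.transcriptProb fhat f := by
  -- `1/8` keeps the densities comparable and `L/8` keeps them Hölder with constant `L`.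
  set c := min (1 / 8) (L / 8) with hc
  have hc0 : 0 < c := by positivity
  have hc1 : c ≤ 1 / 8 := min_le_left _ _
  have hcL : c ≤ L / 8 := min_le_right _ _
  set t := binCount s n k with ht
  have ht1 : 1 ≤ t := one_le_binCount hs0 hn
  -- Rounding up makes the information condition hold; `d ≤ 2t` then loses only `2^(-2s) ≥ 1/4` in
  -- the rate.
  set d := ⌈t⌉₊ with hd
  have hdt : t ≤ d := Nat.le_ceil t
  have hdt2 : (d : ℝ) ≤ 2 * t := by linarith [Nat.ceil_lt_add_one (by linarith : 0 ≤ t)]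
  have hd1 : (1 : ℝ) ≤ d := ht1.trans hdt
  have hd0 : (0 : ℝ) < d := by linarith
  have : NeZero d := ⟨by rintro h; rw [h] at hd1; norm_num at hd1⟩
  have hds : (d : ℝ) ^ (-s) ≤ 1 := Real.rpow_le_one_of_one_le_of_nonpos hd1 (by linarith)
  have hds0 : 0 < (d : ℝ) ^ (-s) := Real.rpow_pos_of_pos hd0 _
  set ε := c * (d : ℝ) ^ (-s) with hε
  have hε0 : 0 ≤ ε := by positivity
  have hε1 : ε ≤ 1 / 8 := by nlinarith
  have hε2 : ε ^ 2 = c ^ 2 * (d : ℝ) ^ (-(2 * s)) := by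
    rw [hε, mul_pow, ← Real.rpow_natCast ((d : ℝ) ^ (-s)), ← Real.rpow_mul hd0.le]
    congr 2; push_cast; ring
  have hc2 : c ^ 2 ≤ 1 / 64 := by nlinarith
  have hdpos : 0 < (d : ℝ) ^ (-(2 * s)) := Real.rpow_pos_of_pos hd0 _
  have hcond : n * (16 * ε ^ 2) ≤ d / 4 ∨ n * (2 ^ k * (8 * ε ^ 2 / d)) ≤ (d : ℝ) / 4 := by
    rcases binCount_rpow_eq (n := n) (k := k) hs0 with h | h
    · left
      have h1 : (n : ℝ) ≤ (d : ℝ) ^ (2 * s + 1) := by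
        rw [← h]; exact Real.rpow_le_rpow (by linarith) hdt (by linarith)
      have h2 : (n : ℝ) * (d : ℝ) ^ (-(2 * s)) ≤ d := by
        calc _ ≤ (d : ℝ) ^ (2 * s + 1) * (d : ℝ) ^ (-(2 * s)) := by gcongr
          _ = d := by rw [← Real.rpow_add hd0]; ring_nf; exact Real.rpow_one _
      rw [hε2]
      calc (n : ℝ) * (16 * (c ^ 2 * (d : ℝ) ^ (-(2 * s))))
          = 16 * c ^ 2 * (n * (d : ℝ) ^ (-(2 * s))) := by ring
        _ ≤ 16 * (1 / 64) * (d : ℝ) := by gcongr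
        _ = (d : ℝ) / 4 := by ring
    · right
      have h1 : (n : ℝ) * 2 ^ k ≤ (d : ℝ) ^ (2 * s + 2) := by
        rw [← h]; exact Real.rpow_le_rpow (by linarith) hdt (by linarith)
      have h2 : (n : ℝ) * 2 ^ k * (d : ℝ) ^ (-(2 * s)) ≤ d ^ 2 := by
        calc _ ≤ (d : ℝ) ^ (2 * s + 2) * (d : ℝ) ^ (-(2 * s)) := by gcongr
          _ = d ^ 2 := by rw [← Real.rpow_add hd0]; ring_nf; exact Real.rpow_two _
      rw [hε2]
      calc (n : ℝ) * (2 ^ k * (8 * (c ^ 2 * (d : ℝ) ^ (-(2 * s))) / d))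
          = 8 * c ^ 2 * (n * 2 ^ k * (d : ℝ) ^ (-(2 * s))) / d := by ring
        _ ≤ 8 * (1 / 64) * (d : ℝ) ^ 2 / d := by gcongr
        _ ≤ (d : ℝ) / 4 := by
          rw [div_le_iff₀ hd0]
          nlinarith
  refine le_trans ?_ (P.le_of_forall_l2Risk_le (d := d) fhat hfhat hε0 hε1 hcond fun θ => ?_)
  · refine ENNReal.ofReal_le_ofReal ?_
    rw [minimaxRate_eq hs0 hn, hε2, ← ht]
    have h1 : (2 * t) ^ (-(2 * s)) ≤ (d : ℝ) ^ (-(2 * s)) :=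
      Real.rpow_le_rpow_of_nonpos hd0 hdt2 (by linarith)
    rw [Real.mul_rpow (by norm_num) (by linarith)] at h1
    have h2 : (1 / 4 : ℝ) ≤ 2 ^ (-(2 * s)) := by
      calc (1 / 4 : ℝ) = 2 ^ (-2 : ℝ) := by
            rw [Real.rpow_neg (by norm_num), Real.rpow_two]; norm_num
        _ ≤ _ := Real.rpow_le_rpow_of_exponent_le (by norm_num) (by linarith)
    have h3 : 0 < t ^ (-(2 * s)) := Real.rpow_pos_of_pos (by linarith) _
    calc c ^ 2 / 32 * t ^ (-(2 * s)) = c ^ 2 / 8 * (1 / 4 * t ^ (-(2 * s))) := by ring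
      _ ≤ c ^ 2 / 8 * (d : ℝ) ^ (-(2 * s)) := by
          gcongr
          exact le_trans (by gcongr) h1
      _ = _ := by ring
  · refine le_iSup₂_of_le (perturbedDensity d ε θ) ?_ le_rfl
    refine perturbedDensity_mem_holderDensities d θ hs0 hs1 hε0 (by linarith) ?_
    rw [hε]
    nlinarith

end BlackboardProtocol

/-! ### The grouped histogram protocol -/

/-- The number of groups when `d` bins are split into groups of `2 ^ k - 1` bins. -/
def groupCount (d k : ℕ) : ℕ := (d - 1) / (2 ^ k - 1) + 1

section grouping

variable {n k d : ℕ}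

lemma one_le_two_pow_sub_one (hk : 1 ≤ k) : 1 ≤ 2 ^ k - 1 := by
  have : 2 ^ 1 ≤ 2 ^ k := Nat.pow_le_pow_right (by norm_num) hk
  omega

lemma groupCount_le (d k : ℕ) [NeZero d] : groupCount d k ≤ d := by
  have h1 := Nat.div_le_self (d - 1) (2 ^ k - 1)
  have h2 := NeZero.pos d
  unfold groupCount
  omega

lemma div_lt_groupCount (k : ℕ) (j : Fin d) : (j : ℕ) / (2 ^ k - 1) < groupCount d k := by
  have : (j : ℕ) / (2 ^ k - 1) ≤ (d - 1) / (2 ^ k - 1) :=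
    Nat.div_le_div_right (by have := j.2; omega)
  unfold groupCount
  omega

lemma groupCount_le_real (d : ℕ) (hk : 1 ≤ k) :
    (groupCount d k : ℝ) ≤ 1 + 2 * d / 2 ^ k := by
  have hK := one_le_two_pow_sub_one hk
  have hpow : (2 : ℝ) ^ k ≤ 2 * ((2 ^ k - 1 : ℕ) : ℝ) := by
    have : 2 ^ k ≤ 2 * (2 ^ k - 1) := by omega
    exact_mod_cast this
  have hKpos : (0 : ℝ) < ((2 ^ k - 1 : ℕ) : ℝ) := by exact_mod_cast hK
  have h1 : (((d - 1) / (2 ^ k - 1) : ℕ) : ℝ) ≤ d / ((2 ^ k - 1 : ℕ) : ℝ) := by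
    refine Nat.cast_div_le.trans ?_
    gcongr
    omega
  have h2 : (d : ℝ) / ((2 ^ k - 1 : ℕ) : ℝ) ≤ 2 * d / 2 ^ k := by
    rw [div_le_div_iff₀ hKpos (by positivity)]
    nlinarith [(Nat.cast_nonneg d : (0 : ℝ) ≤ d)]
  unfold groupCount
  push_cast at h1 ⊢
  linarith

variable (n k d) in
/-- The nodes serving the group of the `j`-th bin. -/
def servingNodes (j : Fin d) : Finset (Fin n) :=
  Finset.univ.filter fun i => (i : ℕ) % groupCount d k = j / (2 ^ k - 1)

lemma div_le_card_servingNodes (j : Fin d) :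
    n / groupCount d k ≤ (servingNodes n k d j).card := by
  have hG : 0 < groupCount d k := Nat.succ_pos _
  have hj := div_lt_groupCount k j
  have hlt : ∀ t < n / groupCount d k, groupCount d k * t + j / (2 ^ k - 1) < n := by
    intro t ht
    have h1 : groupCount d k * (t + 1) ≤ groupCount d k * (n / groupCount d k) :=
      Nat.mul_le_mul_left _ ht
    have h2 := Nat.mul_div_le n (groupCount d k)
    rw [Nat.mul_add, Nat.mul_one] at h1
    omega
  calc n / groupCount d k = (Finset.univ : Finset (Fin (n / groupCount d k))).card := by simp
    _ ≤ _ := by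
      refine Finset.card_le_card_of_injOn
        (fun t => ⟨groupCount d k * t + j / (2 ^ k - 1), hlt t t.2⟩) (fun t _ => ?_) ?_
      · simp [servingNodes, Nat.mod_eq_of_lt hj]
      · intro a _ b _ hab
        simp only [Fin.mk.injEq, Nat.add_right_cancel_iff] at hab
        exact Fin.ext (Nat.eq_of_mul_eq_mul_left hG hab)

/-- Since `G ≤ d ≤ n`, the floor of `n / G` is at least one, so rounding costs at most a factor `2`
and no group is left unserved. -/
lemma le_card_servingNodes_real [NeZero d] (hdn : d ≤ n) (j : Fin d) :
    (n : ℝ) ≤ 2 * groupCount d k * (servingNodes n k d j).card := by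
  have hG : 0 < groupCount d k := Nat.succ_pos _
  have h1 := div_le_card_servingNodes (n := n) (k := k) j
  have h2 : 1 ≤ n / groupCount d k :=
    (Nat.one_le_div_iff hG).2 ((groupCount_le d k).trans hdn)
  have h3 := Nat.lt_mul_div_succ n hG
  have h4 : n ≤ 2 * groupCount d k * (servingNodes n k d j).card := by
    calc n ≤ groupCount d k * (n / groupCount d k + 1) := h3.le
      _ ≤ groupCount d k * (2 * (servingNodes n k d j).card) := by gcongr; omega
      _ = _ := by ring
  exact_mod_cast h4

variable [NeZero d]

variable (k d) in
/-- The message of a node with index `i` and sample `x`: the position of the bin of `x` in the group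
served by the node, or `0` if that bin belongs to another group. -/
noncomputable def groupMessage (i : ℕ) (x : unitInterval) : Fin (2 ^ k) :=
  if (binIndex d x : ℕ) / (2 ^ k - 1) = i % groupCount d k then
    Fin.ofNat (2 ^ k) ((binIndex d x : ℕ) % (2 ^ k - 1) + 1) else 0

lemma measurable_groupMessage (i : ℕ) : Measurable (groupMessage k d i) :=
  (measurable_of_countable fun j : Fin d => if (j : ℕ) / (2 ^ k - 1) = i % groupCount d k then
    Fin.ofNat (2 ^ k) ((j : ℕ) % (2 ^ k - 1) + 1) else 0).comp (measurable_binIndex d)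

/-- A node serving the group of bin `j` reveals whether its sample lies in that bin. -/
lemma groupMessage_eq_iff (hk : 1 ≤ k) {i : Fin n} {j : Fin d} (hi : i ∈ servingNodes n k d j)
    (x : unitInterval) :
    (groupMessage k d i x : ℕ) = (j : ℕ) % (2 ^ k - 1) + 1 ↔ binIndex d x = j := by
  have hK := one_le_two_pow_sub_one hk
  have hi' : (i : ℕ) % groupCount d k = j / (2 ^ k - 1) := (Finset.mem_filter.1 hi).2
  unfold groupMessage
  rw [hi']
  split_ifs with h
  · have hmod := Nat.mod_lt (binIndex d x : ℕ) hK
    -- Positions shifted by one lie in `1, …, 2^k - 1`: there is no wraparound, and `0` remains free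
    -- for samples outside the group.
    rw [Fin.val_ofNat, Nat.mod_eq_of_lt (by omega), Nat.add_right_cancel_iff]
    constructor
    · intro h2
      ext
      rw [← Nat.div_add_mod (binIndex d x : ℕ) (2 ^ k - 1), h, h2, Nat.div_add_mod]
    · rintro rfl; rfl
  · constructor
    · intro h2
      simp at h2
    · rintro rfl; exact absurd rfl h

variable (n k d) in
/-- The deterministic protocol sending `groupMessage`. -/
noncomputable def histogramProtocol : IndependentProtocol unitInterval n k where
  enc i x m := if groupMessage k d i x = m then 1 else 0
  measurable_enc i m :=
    (measurable_of_countable fun m' : Fin (2 ^ k) => if m' = m then (1 : ℝ) else 0).comp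
      (measurable_groupMessage i)
  enc_nonneg i x m := by split_ifs <;> norm_num
  sum_enc i x := by simp

variable (k) in
/-- The estimated probability of bin `j`. -/
noncomputable def binFrequency (j : Fin d) (y : Fin n → Fin (2 ^ k)) : ℝ :=
  ∑ i ∈ servingNodes n k d j,
    ((servingNodes n k d j).card : ℝ)⁻¹ * if (y i : ℕ) = j % (2 ^ k - 1) + 1 then 1 else 0

variable (n k d) in
/-- The histogram estimator. -/
noncomputable def histogramEstimator (y : Fin n → Fin (2 ^ k)) (u : unitInterval) : ℝ :=
  d * binFrequency k (binIndex d u) y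

lemma measurable_histogramEstimator (y : Fin n → Fin (2 ^ k)) :
    Measurable (histogramEstimator n k d y) :=
  (measurable_of_countable fun j : Fin d => (d : ℝ) * binFrequency k j y).comp
    (measurable_binIndex d)

lemma binFrequency_groupMessage (hk : 1 ≤ k) (j : Fin d) (x : Fin n → unitInterval) :
    binFrequency k j (fun i => groupMessage k d i (x i)) = ∑ i ∈ servingNodes n k d j,
      ((servingNodes n k d j).card : ℝ)⁻¹ * if binIndex d (x i) = j then 1 else 0 := by
  refine Finset.sum_congr rfl fun i hi => ?_
  simp only [groupMessage_eq_iff hk hi]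

lemma histogramProtocol_transcriptProb (x : Fin n → unitInterval) (y : Fin n → Fin (2 ^ k)) :
    (histogramProtocol n k d).transcriptProb x y
      = if (fun i : Fin n => groupMessage k d i (x i)) = y then 1 else 0 := by
  simp only [IndependentProtocol.transcriptProb, histogramProtocol, Finset.prod_ite_zero,
    Finset.mem_univ, true_imp_iff, Finset.prod_const_one, funext_iff]

/-- The protocol is deterministic, so for each sample vector a single transcript survives in the
sum. -/
lemma l2Risk_histogramProtocol (f : unitInterval → ℝ)
    (fhat : (Fin n → Fin (2 ^ k)) → unitInterval → ℝ) :
    l2Risk (histogramProtocol n k d).transcriptProb fhat f = ∫⁻ x,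
      (∫⁻ u, ENNReal.ofReal ((f u - fhat (fun i => groupMessage k d i (x i)) u) ^ 2))
        ∂(Measure.pi fun _ : Fin n => sampleLaw f) := by
  rw [l2Risk]
  refine lintegral_congr fun x => ?_
  simp only [histogramProtocol_transcriptProb, eLpNorm_two_sq]
  rw [Finset.sum_eq_single (fun i : Fin n => groupMessage k d i (x i))]
  · simp
  · intro y _ hy
    simp [hy.symm]
  · simp

end grouping

/-! ### Risk of the histogram estimator -/

lemma integrable_sq_weighted_frequency {Ω : Type*} [MeasurableSpace Ω] {n : ℕ} (μ : Measure Ω)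
    [IsProbabilityMeasure μ] {A : Set Ω} (hA : MeasurableSet A) (c : Fin n → ℝ) :
    Integrable (fun x => (μ.real A - ∑ i, c i * A.indicator 1 (x i)) ^ 2)
      (Measure.pi fun _ => μ) := by
  refine MemLp.integrable_sq ?_
  refine (memLp_const _).sub (memLp_finsetSum _ fun i _ => ?_)
  exact ((memLp_indicator_const 2 hA (1 : ℝ) (Or.inr (measure_ne_top μ A))).const_mul
    (c i)).comp_measurePreserving (measurePreserving_eval (fun _ : Fin n => μ) i)

/-- Mean squared error of a weighted empirical frequency. -/
lemma integral_sq_weighted_frequency_le {Ω : Type*} [MeasurableSpace Ω] {n : ℕ} (μ : Measure Ω)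
    [IsProbabilityMeasure μ] {A : Set Ω} (hA : MeasurableSet A) (c : Fin n → ℝ)
    (hc : ∑ i, c i = 1) :
    ∫ x, (μ.real A - ∑ i, c i * A.indicator 1 (x i)) ^ 2 ∂(Measure.pi fun _ => μ)
      ≤ (∑ i, c i ^ 2) * μ.real A := by
  classical
  have hmeas : Measurable (A.indicator (1 : Ω → ℝ)) := measurable_one.indicator hA
  have hX : ∀ i, MemLp (fun ω => c i * A.indicator (1 : Ω → ℝ) ω) 2 μ := fun i =>
    (memLp_indicator_const 2 hA (1 : ℝ) (Or.inr (measure_ne_top μ A))).const_mul (c i)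
  have hint1 : ∫ ω, A.indicator (1 : Ω → ℝ) ω ∂μ = μ.real A := by
    rw [integral_indicator_one hA]
  have hcomp : ∀ i, ∫ x, c i * A.indicator (1 : Ω → ℝ) (x i) ∂(Measure.pi fun _ : Fin n => μ)
      = c i * μ.real A := by
    intro i
    rw [integral_comp_eval (μ := fun _ : Fin n => μ) (i := i)
      (f := fun ω => c i * A.indicator (1 : Ω → ℝ) ω) (hX i).aestronglyMeasurable,
      integral_const_mul, hint1]
  have hintg : ∀ i, Integrable (fun x : Fin n → Ω => c i * A.indicator (1 : Ω → ℝ) (x i))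
      (Measure.pi fun _ => μ) := fun i =>
    ((hX i).comp_measurePreserving (measurePreserving_eval (fun _ : Fin n => μ) i)).integrable
      (by norm_num)
  have hmean : ∫ x, ∑ i, c i * A.indicator (1 : Ω → ℝ) (x i) ∂(Measure.pi fun _ : Fin n => μ)
      = μ.real A := by
    rw [integral_finsetSum _ fun i _ => hintg i]
    simp_rw [hcomp, ← Finset.sum_mul, hc, one_mul]
  have hvar := ProbabilityTheory.variance_sum_pi (μ := fun _ : Fin n => μ) hX
  have heq : (∑ i, fun x : Fin n → Ω => c i * A.indicator (1 : Ω → ℝ) (x i))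
      = fun x => ∑ i, c i * A.indicator (1 : Ω → ℝ) (x i) := by
    ext x; simp
  rw [heq, ProbabilityTheory.variance_eq_integral
    (Finset.aemeasurable_fun_sum _ fun i _ => (hintg i).aemeasurable), hmean] at hvar
  simp_rw [sub_sq_comm (μ.real A)]
  rw [hvar, Finset.sum_mul]
  -- Each variance is at most the second moment, and an indicator is its own square.
  refine Finset.sum_le_sum fun i _ => ?_
  refine (ProbabilityTheory.variance_le_expectation_sq (hX i).aestronglyMeasurable).trans
    (le_of_eq ?_)
  have : ∀ ω, ((fun ω => c i * A.indicator (1 : Ω → ℝ) ω) ^ 2) ω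
      = c i ^ 2 * A.indicator (1 : Ω → ℝ) ω := by
    intro ω
    by_cases h : ω ∈ A <;> simp [h]
  simp_rw [this]
  rw [integral_const_mul, hint1]

section histogramRisk

variable {s L : ℝ} {d : ℕ} [NeZero d] {f : unitInterval → ℝ}

/-- Bias of the histogram. -/
lemma abs_sub_mul_setIntegral_bin_le (hs : 0 < s) (hL : 0 < L) (hf : f ∈ holderDensities s L)
    (u : unitInterval) :
    |f u - d * ∫ v in {x | binIndex d x = binIndex d u}, f v| ≤ L * (d : ℝ) ^ (-s) := by
  have hd : (0 : ℝ) < d := by exact_mod_cast NeZero.pos d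
  have hfi := (continuous_of_mem_holderDensities hs hf).integrable_unitInterval
  have h1 : f u - d * ∫ v in {x | binIndex d x = binIndex d u}, f v
      = d * ∫ v in {x | binIndex d x = binIndex d u}, (f u - f v) := by
    rw [integral_sub (integrable_const _) hfi.integrableOn, setIntegral_const, volume_real_bin,
      smul_eq_mul]
    field_simp
  have h2 : ‖∫ v in {x | binIndex d x = binIndex d u}, (f u - f v)‖
      ≤ L * (d : ℝ) ^ (-s) * volume.real {x | binIndex d x = binIndex d u} := by
    refine norm_setIntegral_le_of_norm_le_const (measure_lt_top _ _) fun v hv => ?_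
    refine (hf.2.2 u v).trans ?_
    have h3 := abs_sub_le_of_binIndex_eq (show binIndex d v = binIndex d u from hv).symm
    rw [Real.rpow_neg hd.le, ← Real.inv_rpow hd.le, ← one_div]
    gcongr
  rw [h1, abs_mul, abs_of_pos hd]
  rw [Real.norm_eq_abs, volume_real_bin] at h2
  calc _ ≤ d * (L * (d : ℝ) ^ (-s) * (1 / d)) := by gcongr
    _ = _ := by field_simp

/-- Squared error of a histogram with bin probabilities `r`. -/
lemma lintegral_sq_sub_histogram_le (hs : 0 < s) (hL : 0 < L) (hf : f ∈ holderDensities s L)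
    (r : Fin d → ℝ) :
    ∫⁻ u, ENNReal.ofReal ((f u - d * r (binIndex d u)) ^ 2) ≤
      ENNReal.ofReal (2 * L ^ 2 * (d : ℝ) ^ (-(2 * s)) +
        2 * d * ∑ j, ((∫ v in {x | binIndex d x = j}, f v) - r j) ^ 2) := by
  have hd : (0 : ℝ) < d := by exact_mod_cast NeZero.pos d
  set p : Fin d → ℝ := fun j => ∫ v in {x | binIndex d x = j}, f v with hp
  have hsq : (L * (d : ℝ) ^ (-s)) ^ 2 = L ^ 2 * (d : ℝ) ^ (-(2 * s)) := by
    rw [mul_pow, ← Real.rpow_natCast ((d : ℝ) ^ (-s)), ← Real.rpow_mul hd.le]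
    congr 2; push_cast; ring
  have hbin : ∀ j, ∫⁻ u in {x | binIndex d x = j},
      ENNReal.ofReal ((f u - d * r (binIndex d u)) ^ 2) ≤
      ENNReal.ofReal ((2 * L ^ 2 * (d : ℝ) ^ (-(2 * s)) + 2 * d ^ 2 * (p j - r j) ^ 2) / d) := by
    intro j
    calc _ ≤ ∫⁻ u in {x | binIndex d x = j},
          ENNReal.ofReal (2 * L ^ 2 * (d : ℝ) ^ (-(2 * s)) + 2 * d ^ 2 * (p j - r j) ^ 2) := by
          refine setLIntegral_mono' (measurableSet_bin d j) fun u hu => ?_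
          refine ENNReal.ofReal_le_ofReal ?_
          have hb := abs_sub_mul_setIntegral_bin_le (d := d) hs hL hf u
          have hu : binIndex d u = j := hu
          rw [hu] at hb ⊢
          have hb2 : (f u - d * p j) ^ 2 ≤ L ^ 2 * (d : ℝ) ^ (-(2 * s)) := by
            rw [← hsq, ← sq_abs]
            exact pow_le_pow_left₀ (abs_nonneg _) hb 2
          -- Bias and estimation error are separated by `(a + b)² ≤ 2a² + 2b²`.
          nlinarith [sq_nonneg ((f u - d * p j) - (d * (p j - r j)))]
      _ = _ := by
          rw [setLIntegral_const, div_eq_mul_one_div, ENNReal.ofReal_mul (by positivity),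
            ← volume_real_bin d j, ofReal_measureReal]
  rw [lintegral_eq_sum_bin d]
  refine (Finset.sum_le_sum fun j _ => hbin j).trans (le_of_eq ?_)
  rw [← ENNReal.ofReal_sum_of_nonneg fun j _ => by positivity]
  congr 1
  change _ = 2 * L ^ 2 * (d : ℝ) ^ (-(2 * s)) + 2 * d * ∑ j, (p j - r j) ^ 2
  rw [← Finset.sum_div, Finset.sum_add_distrib,
    ← Finset.mul_sum Finset.univ (fun j => (p j - r j) ^ 2) (2 * (d : ℝ) ^ 2)]
  simp only [Finset.sum_const, Finset.card_univ, Fintype.card_fin, nsmul_eq_mul]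
  field_simp

lemma sampleLaw_real_eq (hf : Continuous f) (hf0 : ∀ x, 0 ≤ f x)
    {A : Set unitInterval} (hA : MeasurableSet A) :
    (sampleLaw f).real A = ∫ v in A, f v := by
  rw [measureReal_def, sampleLaw, withDensity_apply _ hA,
    ← ofReal_integral_eq_lintegral_ofReal hf.integrable_unitInterval.integrableOn
      (.of_forall hf0), ENNReal.toReal_ofReal (setIntegral_nonneg hA fun x _ => hf0 x)]

/-- The mean squared error of the `j`-th frequency is at most `p_j / N_j ≤ (2G / n) p_j`. Keeping
`p_j` matters: the bin probabilities sum to one, so the sum over the bins costs no further factor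
`d`. -/
lemma l2Risk_histogramEstimator_le {n k : ℕ} (hs : 0 < s) (hL : 0 < L)
    (hf : f ∈ holderDensities s L) (hn : 1 ≤ n) (hk : 1 ≤ k) (hdn : d ≤ n) :
    l2Risk (histogramProtocol n k d).transcriptProb (histogramEstimator n k d) f ≤
      ENNReal.ofReal (2 * L ^ 2 * (d : ℝ) ^ (-(2 * s)) + 4 * d * groupCount d k / n) := by
  have hd : (0 : ℝ) < d := by exact_mod_cast NeZero.pos d
  have hn0 : (0 : ℝ) < n := by exact_mod_cast hn
  have hG : (0 : ℝ) < groupCount d k := by exact_mod_cast Nat.succ_pos _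
  have hfc := continuous_of_mem_holderDensities hs hf
  have := isProbabilityMeasure_sampleLaw hfc.integrable_unitInterval hf.1 hf.2.1
  set μ := sampleLaw f with hμ
  set p : Fin d → ℝ := fun j => ∫ v in {x | binIndex d x = j}, f v with hp
  have hpμ : ∀ j, μ.real {x | binIndex d x = j} = p j := fun j =>
    sampleLaw_real_eq hfc hf.1 (measurableSet_bin d j)
  have hpsum : ∑ j, p j = 1 := by
    rw [← hf.2.1, integral_eq_sum_bin d hfc.integrable_unitInterval]
  set N : Fin d → ℝ := fun j => (servingNodes n k d j).card with hN
  have hnN : ∀ j, (n : ℝ) ≤ 2 * groupCount d k * N j := le_card_servingNodes_real hdn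
  have hN0 : ∀ j, 0 < N j := fun j => by
    have h := hn0.trans_le (hnN j)
    exact pos_of_mul_pos_right h (by positivity)
  set c : Fin d → Fin n → ℝ := fun j i => if i ∈ servingNodes n k d j then (N j)⁻¹ else 0 with hc
  have hc1 : ∀ j, ∑ i, c j i = 1 := fun j => by
    simp only [hc, Finset.sum_ite_mem, Finset.univ_inter, Finset.sum_const, nsmul_eq_mul]
    exact mul_inv_cancel₀ (hN0 j).ne'
  have hc2 : ∀ j, ∑ i, c j i ^ 2 = (N j)⁻¹ := fun j => by
    simp only [hc, ite_pow, ne_eq, OfNat.ofNat_ne_zero, not_false_eq_true, zero_pow,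
      Finset.sum_ite_mem, Finset.univ_inter, Finset.sum_const, nsmul_eq_mul]
    change N j * (N j)⁻¹ ^ 2 = _
    have := (hN0 j).ne'
    field_simp
  have hfreq : ∀ j (x : Fin n → unitInterval),
      binFrequency k j (fun i => groupMessage k d i (x i))
        = ∑ i, c j i * {x | binIndex d x = j}.indicator (1 : unitInterval → ℝ) (x i) := by
    intro j x
    rw [binFrequency_groupMessage hk]
    simp only [hc, ite_mul, zero_mul, Finset.sum_ite_mem, Finset.univ_inter]
    refine Finset.sum_congr rfl fun i _ => ?_
    by_cases h : binIndex d (x i) = j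
    · rw [if_pos h, Set.indicator_of_mem (by exact h)]; rfl
    · rw [if_neg h, Set.indicator_of_notMem (by exact h)]
  set F : Fin d → (Fin n → unitInterval) → ℝ := fun j x => (μ.real {x | binIndex d x = j} -
    ∑ i, c j i * {x | binIndex d x = j}.indicator (1 : unitInterval → ℝ) (x i)) ^ 2 with hF
  have hFi : ∀ j, Integrable (F j) (Measure.pi fun _ => μ) := fun j =>
    integrable_sq_weighted_frequency μ (measurableSet_bin d j) (c j)
  have hFle : ∀ j, ∫ x, F j x ∂(Measure.pi fun _ => μ) ≤ 2 * groupCount d k / n * p j := by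
    intro j
    refine (integral_sq_weighted_frequency_le μ (measurableSet_bin d j) (c j) (hc1 j)).trans ?_
    rw [hc2, hpμ]
    have hpj : 0 ≤ p j := setIntegral_nonneg (measurableSet_bin d j) fun x _ => hf.1 x
    refine mul_le_mul_of_nonneg_right ?_ hpj
    rw [inv_le_iff_one_le_mul₀ (hN0 j), div_mul_eq_mul_div, one_le_div hn0]
    exact hnN j
  rw [l2Risk_histogramProtocol]
  calc _ ≤ ∫⁻ x, ENNReal.ofReal (2 * L ^ 2 * (d : ℝ) ^ (-(2 * s)) + 2 * d * ∑ j, F j x)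
        ∂(Measure.pi fun _ : Fin n => μ) := by
        refine lintegral_mono fun x => ?_
        have h := lintegral_sq_sub_histogram_le hs hL hf
          fun j : Fin d => binFrequency k j fun i : Fin n => groupMessage k d i (x i)
        simp only [hF, ← hfreq, hpμ]
        exact h
    _ = ENNReal.ofReal (∫ x, (2 * L ^ 2 * (d : ℝ) ^ (-(2 * s)) + 2 * d * ∑ j, F j x)
        ∂(Measure.pi fun _ : Fin n => μ)) := by
        refine (ofReal_integral_eq_lintegral_ofReal ?_ (.of_forall fun x => ?_)).symm
        · exact (integrable_const _).add ((integrable_finsetSum _ fun j _ => hFi j).const_mul _)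
        · have : 0 ≤ ∑ j, F j x := Finset.sum_nonneg fun j _ => sq_nonneg _
          change 0 ≤ 2 * L ^ 2 * (d : ℝ) ^ (-(2 * s)) + 2 * d * ∑ j, F j x
          positivity
    _ ≤ _ := by
        refine ENNReal.ofReal_le_ofReal ?_
        rw [integral_add (integrable_const _)
          ((integrable_finsetSum _ fun j _ => hFi j).const_mul _), integral_const, integral_const_mul,
          integral_finsetSum _ fun j _ => hFi j]
        have h1 : ∑ j, ∫ x, F j x ∂(Measure.pi fun _ => μ) ≤ 2 * groupCount d k / n := by
          refine (Finset.sum_le_sum fun j _ => hFle j).trans (le_of_eq ?_)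
          rw [← Finset.mul_sum, hpsum, mul_one]
        have h2 : 2 * (d : ℝ) * ∑ j, ∫ x, F j x ∂(Measure.pi fun _ => μ)
            ≤ 2 * d * (2 * groupCount d k / n) := by gcongr
        have h3 : 2 * (d : ℝ) * (2 * groupCount d k / n) = 4 * d * groupCount d k / n := by ring
        simp only [probReal_univ, one_smul]
        linarith

end histogramRisk

/-! ### The minimax upper bound and the theorem -/

lemma exists_iSup_l2Risk_le_minimaxRate {s L : ℝ} (hs0 : 0 < s) (hs1 : s ≤ 1) (hL : 0 < L)
    {n k : ℕ} (hn : 1 ≤ n) (hk : 1 ≤ k) :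
    ∃ (P : IndependentProtocol unitInterval n k)
      (fhat : (Fin n → Fin (2 ^ k)) → unitInterval → ℝ),
      (∀ y, Measurable (fhat y)) ∧
      (⨆ f ∈ holderDensities s L, l2Risk P.transcriptProb fhat f) ≤
        ENNReal.ofReal ((8 * L ^ 2 + 12) * minimaxRate s n k) := by
  set t := binCount s n k with ht
  have hn0 : (0 : ℝ) < n := by exact_mod_cast hn
  have ht1 : 1 ≤ t := one_le_binCount hs0 hn
  have ht0 : 0 < t := by linarith
  -- Rounding down keeps `d ≤ n` and the variance bound in terms of `t`; `d ≥ t / 2` costs a factor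
  -- `2^(2s) ≤ 4` in the squared bias.
  set d := ⌊t⌋₊ with hd
  have hd1 : 1 ≤ d := Nat.le_floor (by simpa using ht1)
  have : NeZero d := ⟨by omega⟩
  have hd0 : (0 : ℝ) < d := by exact_mod_cast hd1
  have hdt : (d : ℝ) ≤ t := Nat.floor_le ht0.le
  have htd : t / 2 ≤ d := by
    have h1 := Nat.lt_floor_add_one t
    have h2 : (1 : ℝ) ≤ d := by exact_mod_cast hd1
    rw [← hd] at h1
    linarith
  have htn : t ^ (2 * s + 1) ≤ n := binCount_rpow_le hs0
  have htnk : t ^ (2 * s + 2) ≤ n * 2 ^ k := binCount_rpow_le' hs0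
  have hdn : d ≤ n := by
    have h1 : t ≤ t ^ (2 * s + 1) := by
      simpa using Real.rpow_le_rpow_of_exponent_le ht1 (by linarith : (1 : ℝ) ≤ 2 * s + 1)
    exact_mod_cast hdt.trans (h1.trans htn)
  refine ⟨histogramProtocol n k d, histogramEstimator n k d, measurable_histogramEstimator,
    iSup₂_le fun f hf => (l2Risk_histogramEstimator_le hs0 hL hf hn hk hdn).trans ?_⟩
  refine ENNReal.ofReal_le_ofReal ?_
  rw [minimaxRate_eq hs0 hn, ← ht]
  set R := t ^ (-(2 * s)) with hR
  have hR0 : 0 < R := Real.rpow_pos_of_pos ht0 _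
  have hbias : (d : ℝ) ^ (-(2 * s)) ≤ 4 * R := by
    calc (d : ℝ) ^ (-(2 * s)) ≤ (t / 2) ^ (-(2 * s)) :=
          Real.rpow_le_rpow_of_nonpos (by positivity) htd (by linarith)
      _ = 2 ^ (2 * s) * R := by
          rw [div_eq_mul_inv, mul_comm, Real.mul_rpow (by norm_num) ht0.le,
            Real.inv_rpow (by norm_num), Real.rpow_neg (by norm_num), inv_inv]
      _ ≤ 4 * R := by
          gcongr
          calc (2 : ℝ) ^ (2 * s) ≤ 2 ^ (2 : ℝ) :=
                Real.rpow_le_rpow_of_exponent_le (by norm_num) (by linarith)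
            _ = 4 := by rw [Real.rpow_two]; norm_num
  have hv1 : t / n ≤ R := by
    rw [div_le_iff₀ hn0]
    calc t = R * t ^ (2 * s + 1) := by
          rw [hR, ← Real.rpow_add ht0]; ring_nf; exact (Real.rpow_one t).symm
      _ ≤ R * n := by gcongr
  have hv2 : t ^ 2 / (n * 2 ^ k) ≤ R := by
    rw [div_le_iff₀ (by positivity)]
    calc t ^ 2 = R * t ^ (2 * s + 2) := by
          rw [hR, ← Real.rpow_add ht0]; ring_nf; exact (Real.rpow_two t).symm
      _ ≤ R * (n * 2 ^ k) := by gcongr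
  have hG := groupCount_le_real d hk
  have hvar : 4 * d * groupCount d k / n ≤ 12 * R := by
    calc 4 * (d : ℝ) * groupCount d k / n ≤ 4 * t * (1 + 2 * t / 2 ^ k) / n := by
          gcongr
          exact hG.trans (by gcongr)
      _ = 4 * (t / n) + 8 * (t ^ 2 / (n * 2 ^ k)) := by field_simp; ring
      _ ≤ 12 * R := by linarith
  nlinarith [mul_le_mul_of_nonneg_left hbias (by positivity : 0 ≤ 2 * L ^ 2)]

theorem theorem4 (s L : ℝ) (hs0 : 0 < s) (hs1 : s ≤ 1) (hL : 0 < L) :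
    ∃ c C : ℝ, 0 < c ∧ 0 < C ∧ ∀ n k : ℕ, 1 ≤ n → 1 ≤ k →
      (∀ (P : BlackboardProtocol unitInterval n k)
          (fhat : (Fin (n * k) → Bool) → unitInterval → ℝ),
          (∀ y, AEStronglyMeasurable (fhat y) volume) →
          ENNReal.ofReal (c * minimaxRate s n k) ≤
            (⨆ f ∈ holderDensities s L, l2Risk P.transcriptProb fhat f)) ∧
      (∃ (P : IndependentProtocol unitInterval n k)
          (fhat : (Fin n → Fin (2 ^ k)) → unitInterval → ℝ),
          (∀ y, Measurable (fhat y)) ∧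
          (⨆ f ∈ holderDensities s L, l2Risk P.transcriptProb fhat f) ≤
            ENNReal.ofReal (C * minimaxRate s n k)) := by
  refine ⟨min (1 / 8) (L / 8) ^ 2 / 32, 8 * L ^ 2 + 12, by positivity, by positivity,
    fun n k hn hk => ⟨fun P fhat hfhat => ?_, ?_⟩⟩
  · exact P.minimaxRate_le_iSup_l2Risk hs0 hs1 hL hn fhat hfhat
  · exact exists_iSup_l2Risk_le_minimaxRate hs0 hs1 hL hn hk
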